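/- Conventions. A unital $C^*$-algebra $M$ is an $AW^*$-algebra if it is a Baer $*$-ring, i.e. if for every subset $S\subseteq M$ there is a projection $p\in M$ with $\{x\in M : sx=0 \text{ for all } s\in S\}=pM$; it is finite if $v^*v=1$ implies $vv^*=1$ for $v\in M$. A quasitrace on a unital $C^*$-algebra $M$ is a function $\tau:M\to\mathbb C$ such that (i) $\tau(x^*x)=\tau(xx^*)\ge 0$ for all $x\in M$; (ii) $\tau(a+ib)=\tau(a)+i\tau(b)$ for all self-adjoint $a,b\in M$; (iii) $\tau$ is linear on every abelian $C^*$-subalgebra of $M$; (iv) there is a function $\tau_2:M_2(M)\to\mathbb C$ satisfying (i), (ii), (iii) on $M_2(M)$ such that $\tau(x)=\tau_2(x\otimes e_{11})$ for all $x\in M$. It is faithful if $\tau(x^*x)=0$ implies $x=0$. A quasitrace $\tau$ on an $AW^*$-algebra $M$ is normal if $\tau\big(\bigvee_{i\in I}p_i\big)=\sum_{i\in I}\tau(p_i)$ for every orthogonal set $(p_i)_{i\in I}$ of projections in $M$. For a faithful quasitrace $\tau$ put $\|x\|_2=\tau(x^*x)^{1/2}$; then $d_\tau(x,y)=\|x-y\|_2^{2/3}$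 is a metric on $M$. An $AW^*$-subalgebra of an $AW^*$-algebra $M$ is a $C^*$-subalgebra $C$ of $M$ which is itself an $AW^*$-algebra and which contains the supremum $\bigvee_{i\in I} p_i$, computed in the projection lattice of $M$, of every orthogonal set $(p_i)_{i\in I}$ of projections in $C$. **Proposition 3.12.** Let $M$ be a finite $AW^*$-algebra with a faithful normal quasitrace $\tau$, and let $A$ be a unital $C^*$-subalgebra of $M$ (that is, a norm-closed $*$-subalgebra containing the unit of $M$). Then the closure of $A$ in $M$ with respect to the metric $d_\tau$ is the smallest $AW^*$-subalgebra of $M$ containing $A$: it is an $AW^*$-subalgebra of $M$ containing $A$, and it is contained in every $AW^*$-subalgebra of $M$ that contains $A$. -/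

import Mathlib

open scoped ComplexOrder

/-- A Baer `*`-ring: the right annihilator of every subset is the right ideal `p R` generated by a
projection `p` (note that `x ∈ p R` if and only if `p * x = x`). -/
def IsBaerStarRing (R : Type*) [Ring R] [StarRing R] : Prop :=
  ∀ S : Set R, ∃ p : R, IsStarProjection p ∧ ∀ x : R, (∀ s ∈ S, s * x = 0) ↔ p * x = x

/-- An `AW*`-algebra: a (unital) C*-algebra which is a Baer `*`-ring. -/
def IsAWStarAlgebra (M : Type*) [CStarAlgebra M] : Prop :=
  IsBaerStarRing M

/-- Finiteness: every isometry is a unitary, i.e. `1` is not Murray–von Neumann equivalent to a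
proper subprojection. -/
def IsFiniteStarAlgebra (M : Type*) [CStarAlgebra M] : Prop :=
  ∀ v : M, star v * v = 1 → v * star v = 1

/-- A set of pairwise orthogonal projections. -/
structure IsOrthogonalProjectionSet {R : Type*} [Ring R] [StarRing R] (S : Set R) : Prop where
  isStarProjection : ∀ s ∈ S, IsStarProjection s
  orthogonal : ∀ s ∈ S, ∀ t ∈ S, s ≠ t → s * t = 0

/-- `p` is the least upper bound of the set `S` of projections in the partially ordered set of all
projections of `R`, where `p ≤ q` means `p * q = p`. -/
structure IsProjectionSup {R : Type*} [Ring R] [StarRing R] (S : Set R) (p : R) : Prop where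
  isStarProjection : IsStarProjection p
  upper : ∀ s ∈ S, s * p = s
  least : ∀ q : R, IsStarProjection q → (∀ s ∈ S, s * q = s) → p * q = p

/-- The three conditions defining a `1`-quasitrace `τ : R → ℂ`. The order on `ℂ` is the usual one,
so `0 ≤ z` says that `z` is real and nonnegative. The abelian C*-subalgebras in the third condition
need not contain the unit of `R`. -/
structure IsOneQuasitrace {R : Type*} [Ring R] [StarRing R] [Algebra ℂ R] [TopologicalSpace R]
    (τ : R → ℂ) : Prop where
  star_mul_self_comm : ∀ x : R, τ (star x * x) = τ (x * star x)
  star_mul_self_nonneg : ∀ x : R, 0 ≤ τ (star x * x)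
  re_im : ∀ a b : R, IsSelfAdjoint a → IsSelfAdjoint b →
    τ (a + Complex.I • b) = τ a + Complex.I * τ b
  linear_on_abelian : ∀ B : NonUnitalStarSubalgebra ℂ R, IsClosed (B : Set R) →
    (∀ x ∈ B, ∀ y ∈ B, x * y = y * x) →
      (∀ x ∈ B, ∀ y ∈ B, τ (x + y) = τ x + τ y) ∧ ∀ (c : ℂ), ∀ x ∈ B, τ (c • x) = c * τ x

/-- A quasitrace (that is, a `2`-quasitrace) on a unital C*-algebra: a `1`-quasitrace which is the
restriction to the upper left corner, `x ↦ x ⊗ e₁₁`, of a `1`-quasitrace on the `2 × 2` matrices. -/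
structure IsQuasitrace {M : Type*} [CStarAlgebra M] (τ : M → ℂ) : Prop where
  isOneQuasitrace : IsOneQuasitrace τ
  exists_two : ∃ τ₂ : CStarMatrix (Fin 2) (Fin 2) M → ℂ, IsOneQuasitrace τ₂ ∧
    ∀ x : M, τ x = τ₂ (CStarMatrix.ofMatrix !![x, 0; 0, 0])

/-- Faithfulness of a quasitrace. -/
def IsFaithfulQuasitrace {M : Type*} [CStarAlgebra M] (τ : M → ℂ) : Prop :=
  ∀ x : M, τ (star x * x) = 0 → x = 0

/-- Normality of a quasitrace: `τ (⋁ pᵢ) = ∑ τ (pᵢ)` for all orthogonal sets of projections that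
have a supremum (in an `AW*`-algebra, all of them). -/
def IsNormalQuasitrace {M : Type*} [CStarAlgebra M] (τ : M → ℂ) : Prop :=
  ∀ S : Set M, IsOrthogonalProjectionSet S → ∀ p : M, IsProjectionSup S p →
    HasSum (fun s : S => τ (s : M)) (τ p)

/-- `‖x‖₂ = τ(x* x)^{1/2}`. -/
noncomputable def quasiNormTwo {M : Type*} [CStarAlgebra M] (τ : M → ℂ) (x : M) : ℝ :=
  Real.sqrt (τ (star x * x)).re

/-- `d_τ(x, y) = ‖x - y‖₂^{2/3}`. -/
noncomputable def quasiDist {M : Type*} [CStarAlgebra M] (τ : M → ℂ) (x y : M) : ℝ :=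
  quasiNormTwo τ (x - y) ^ (2 / 3 : ℝ)

/-- The closure of a set with respect to `d_τ`. -/
def quasiClosure {M : Type*} [CStarAlgebra M] (τ : M → ℂ) (s : Set M) : Set M :=
  {x | ∀ ε : ℝ, 0 < ε → ∃ a ∈ s, quasiDist τ x a < ε}

/-- A unital `*`-subalgebra `C` of the `AW*`-algebra `M` is an `AW*`-subalgebra if it is a
C*-subalgebra (norm closed), is an `AW*`-algebra in its own right, and contains the suprema,
computed in `M`, of all orthogonal sets of projections of `C`. -/
structure IsAWStarSubalgebra {M : Type*} [CStarAlgebra M] (C : StarSubalgebra ℂ M) : Prop where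
  isClosed : IsClosed (C : Set M)
  isBaerStarRing : IsBaerStarRing C
  sup_mem : ∀ S : Set M, S ⊆ (C : Set M) → IsOrthogonalProjectionSet S →
    ∀ p : M, IsProjectionSup S p → p ∈ C

/-! A quasitrace is additive only on commuting elements, so the first task is to show that the
`2`-norm still behaves like a norm up to constants. Spectral comparison gives `τ c ≤ 2 (τ a + τ b)`
for positive elements with `c ≤ a + b` (`re_le_two_mul_add`): equivalence of projections and
normality make `τ` subadditive on suprema of projections, and integrating over spectral levels
passes to positive elements. Hence the `2`-norm satisfies a quasi-triangle inequality,
multiplication by a fixed element is `2`-norm continuous, and the closure `D` of `A` is a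
`*`-algebra.

A `2`-norm closed `*`-algebra contains suprema of orthogonal sets of its projections, by normality,
and right supports of its elements, which are `2`-norm limits of continuous functional calculus
(`IsFaithfulNormal.support_mem`). Zorn's lemma then gives supports of arbitrary subsets, so `D` is
an `AW*`-subalgebra.

Conversely, an `AW*`-subalgebra `C` is `2`-norm closed (`quasiClosure_subset`). By Chebyshev and
Egorov, an element of its closure falls into `C` after cutting by a projection of small cotrace.
This forces projections of the closure into `C`; positive elements follow as norm limits of
combinations of their spectral projections, and these span. -/

/-! ### Right supports in Baer `*`-rings. -/

section Support

variable {R : Type*} [Ring R] [StarRing R]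

/-- `p` is the right support of the set `S`: the projection whose complement generates the right
annihilator of `S`. -/
structure IsRightSupport (S : Set R) (p : R) : Prop where
  isStarProjection : IsStarProjection p
  iff : ∀ y, (∀ s ∈ S, s * y = 0) ↔ p * y = 0

theorem IsBaerStarRing.exists_isRightSupport (h : IsBaerStarRing R) (S : Set R) :
    ∃ p, IsRightSupport S p := by
  obtain ⟨p, hp, hS⟩ := h S
  refine ⟨1 - p, hp.one_sub, fun y => ?_⟩
  rw [hS y, sub_mul, one_mul, sub_eq_zero, eq_comm]

theorem IsStarProjection.mul_eq_left_comm {p q : R} (hp : IsStarProjection p)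
    (hq : IsStarProjection q) (h : p * q = p) : q * p = p := by
  have := congrArg star h
  rwa [star_mul, hp.isSelfAdjoint.star_eq, hq.isSelfAdjoint.star_eq] at this

theorem IsStarProjection.mul_eq_right_comm {p q : R} (hp : IsStarProjection p)
    (hq : IsStarProjection q) (h : q * p = p) : p * q = p := by
  have := congrArg star h
  rwa [star_mul, hp.isSelfAdjoint.star_eq, hq.isSelfAdjoint.star_eq] at this

theorem IsStarProjection.mul_eq_zero_comm {p q : R} (hp : IsStarProjection p)
    (hq : IsStarProjection q) (h : p * q = 0) : q * p = 0 := by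
  have := congrArg star h
  rwa [star_mul, hp.isSelfAdjoint.star_eq, hq.isSelfAdjoint.star_eq, star_zero] at this

theorem IsStarProjection.mul_self {p : R} (hp : IsStarProjection p) : p * p = p :=
  hp.isIdempotentElem

theorem IsStarProjection.star_eq {p : R} (hp : IsStarProjection p) : star p = p :=
  hp.isSelfAdjoint

namespace IsRightSupport

variable {S : Set R} {p q : R}

theorem mul_eq (h : IsRightSupport S p) {s : R} (hs : s ∈ S) : s * p = s := by
  have := (h.iff (1 - p)).2 h.isStarProjection.mul_one_sub_self s hs
  rw [mul_sub, mul_one, sub_eq_zero] at this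
  exact this.symm

theorem mul_eq_self_of_forall (h : IsRightSupport S p) (hS : ∀ s ∈ S, s * q = s) : p * q = p := by
  have := (h.iff (1 - q)).1 fun s hs => by rw [mul_sub, mul_one, hS s hs, sub_self]
  rw [mul_sub, mul_one, sub_eq_zero] at this
  exact this.symm

theorem isProjectionSup (h : IsRightSupport S p) : IsProjectionSup S p :=
  ⟨h.isStarProjection, fun _ hs => h.mul_eq hs, fun _ _ hS => h.mul_eq_self_of_forall hS⟩

theorem congr {S' : Set R} (h : IsRightSupport S p)
    (hS : ∀ y, (∀ s ∈ S', s * y = 0) ↔ ∀ s ∈ S, s * y = 0) : IsRightSupport S' p :=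
  ⟨h.isStarProjection, fun y => (hS y).trans (h.iff y)⟩

theorem mul_eq_zero_iff {x : R} (h : IsRightSupport {x} p) (y : R) : x * y = 0 ↔ p * y = 0 := by
  rw [← h.iff]; simp

/-- The right annihilator `(1 - p) R` of `x` is stable under left multiplication by anything
commuting with `x`, so `p * y * (1 - p) = 0`. As `x` is self-adjoint, the same holds for `star y`.
-/
theorem commute {x y : R} (h : IsRightSupport {x} p) (hx : IsSelfAdjoint x) (hxy : Commute x y) :
    Commute p y := by
  have key : ∀ z, Commute x z → p * z = p * z * p := by
    intro z hz
    have h1 : p * (z * (1 - p)) = 0 := by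
      rw [← h.mul_eq_zero_iff, ← mul_assoc, hz.eq, mul_assoc,
        (h.mul_eq_zero_iff _).2 h.isStarProjection.mul_one_sub_self, mul_zero]
    rw [mul_sub, mul_one, mul_sub, sub_eq_zero] at h1
    rw [mul_assoc, ← h1]
  have h2 := key (star y) (by
    have := hxy.star_star
    rwa [hx.star_eq] at this)
  have h3 := congrArg star h2
  simp only [star_mul, star_star, h.isStarProjection.star_eq] at h3
  rw [Commute, SemiconjBy, key y hxy, h3, mul_assoc]

end IsRightSupport

end Support

/-! ### Spectral projections as supports of cutoffs. -/

section Spectral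

variable {R : Type*} [CStarAlgebra R]

theorem IsRightSupport.star_mul_self_iff {x p : R} :
    IsRightSupport {star x * x} p ↔ IsRightSupport {x} p := by
  have key : ∀ y : R, star x * x * y = 0 ↔ x * y = 0 := fun y => by
    refine ⟨fun h => ?_, fun h => by rw [mul_assoc, h, mul_zero]⟩
    rw [← CStarRing.star_mul_self_eq_zero_iff, star_mul, mul_assoc, ← mul_assoc _ x y, h, mul_zero]
  constructor <;> exact fun h => h.congr fun y => by simp [key]

/-- The truncation `(a - t)₊`. -/
noncomputable def cutoff (a : R) (t : ℝ) : R := cfc (fun s : ℝ => max (s - t) 0) a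

theorem isSelfAdjoint_cutoff (a : R) (t : ℝ) : IsSelfAdjoint (cutoff a t) :=
  cfc_predicate _ _

/-- `e` is the spectral projection of `a` for the half line `(t, ∞)`. -/
def IsSpectralProj (a : R) (t : ℝ) (e : R) : Prop := IsRightSupport {cutoff a t} e

variable {a : R} {s t : ℝ} {e f : R}

theorem IsBaerStarRing.exists_isSpectralProj (h : IsBaerStarRing R) (a : R) (t : ℝ) :
    ∃ e, IsSpectralProj a t e :=
  h.exists_isRightSupport _

theorem cutoff_eq_zero (h : ‖a‖ ≤ t) : cutoff a t = 0 := by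
  nontriviality R
  rw [cutoff, ← cfc_zero (R := ℝ) a]
  refine cfc_congr fun s hs => ?_
  have := (le_abs_self s).trans ((spectrum.norm_le_norm_of_mem hs).trans h)
  simp [sub_nonpos.2 this]

namespace IsSpectralProj

theorem isStarProjection (he : IsSpectralProj a t e) : IsStarProjection e :=
  IsRightSupport.isStarProjection he

theorem cutoff_mul (he : IsSpectralProj a t e) : cutoff a t * e = cutoff a t :=
  IsRightSupport.mul_eq he rfl

theorem commute_of_commute_cutoff (he : IsSpectralProj a t e) {y : R}
    (hy : Commute (cutoff a t) y) : Commute e y :=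
  IsRightSupport.commute he (isSelfAdjoint_cutoff a t) hy

theorem commute_cfc (he : IsSpectralProj a t e) (g : ℝ → ℝ) : Commute e (cfc g a) :=
  he.commute_of_commute_cutoff (cfc_commute_cfc _ _ _)

theorem commute_cutoff (he : IsSpectralProj a t e) (s : ℝ) : Commute e (cutoff a s) :=
  he.commute_cfc _

theorem commute (he : IsSpectralProj a t e) (ha : IsSelfAdjoint a) : Commute e a := by
  have := he.commute_cfc id
  rwa [cfc_id ℝ a] at this

/-- On the range of a spectral projection, the functional calculus only depends on the values of
the function on the half line. -/
theorem mul_cfc_congr (he : IsSpectralProj a t e) {g k : ℝ → ℝ}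
    (hg : Continuous g) (hk : Continuous k) (h : ∀ s ∈ spectrum ℝ a, t < s → g s = k s) :
    e * cfc g a = e * cfc k a := by
  rw [← sub_eq_zero, ← mul_sub, ← cfc_sub g k a hg.continuousOn hk.continuousOn,
    ← IsRightSupport.mul_eq_zero_iff he, cutoff, ← cfc_mul _ _ a (by fun_prop) (by fun_prop),
    ← cfc_zero (R := ℝ) a]
  refine cfc_congr fun s hs => ?_
  rcases le_or_gt s t with hst | hst
  · simp [max_eq_right (sub_nonpos.2 hst)]
  · simp [h s hs hst]

theorem mul_cfc_eq_smul (he : IsSpectralProj a t e) (ha : IsSelfAdjoint a) {g : ℝ → ℝ}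
    (hg : Continuous g) {c : ℝ} (h : ∀ s ∈ spectrum ℝ a, t < s → g s = c) :
    e * cfc g a = c • e := by
  rw [he.mul_cfc_congr hg continuous_const h, cfc_const c a, Algebra.algebraMap_eq_smul_one,
    mul_smul_comm, mul_one]

/-- A bounded inverse of `a` on the range of a spectral projection. -/
theorem exists_inverse (he : IsSpectralProj a t e) (ht : 0 < t) (ha : IsSelfAdjoint a) :
    ∃ w : R, IsSelfAdjoint w ∧ Commute w e ∧ Commute w a ∧ w * w * a * e = e := by
  -- The inverse square root, frozen below `t` to stay continuous; the root makes `x * w * e` a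
  -- partial isometry when `a = star x * x`.
  let g : ℝ → ℝ := fun s => (√(max s t))⁻¹
  have hg : Continuous g := by
    refine Continuous.inv₀ (by fun_prop) fun s => ?_
    have : 0 < max s t := lt_max_of_lt_right ht
    positivity
  have hc : Commute (cfc g a) a := by
    have := cfc_commute_cfc g id a
    rwa [cfc_id ℝ a] at this
  refine ⟨cfc g a, cfc_predicate _ _, (he.commute_cfc _).symm, hc, ?_⟩
  have h1 : cfc g a * cfc g a * a = cfc (fun s => g s * g s * s) a := by
    rw [cfc_mul _ _ a (by fun_prop) (by fun_prop), cfc_mul _ _ a (by fun_prop) (by fun_prop),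
      cfc_id' ℝ a]
  rw [h1, ← (he.commute_cfc _).eq, he.mul_cfc_eq_smul ha (c := 1) (by fun_prop), one_smul]
  intro s _ hs
  have : 0 < s := ht.trans hs
  simp only [g, max_eq_left hs.le]
  rw [← mul_inv, Real.mul_self_sqrt this.le, inv_mul_cancel₀ this.ne']

end IsSpectralProj

variable [PartialOrder R] [StarOrderedRing R]

theorem mul_eq_zero_of_conj_eq_zero {b y : R} (hb : 0 ≤ b) (h : star y * b * y = 0) :
    b * y = 0 := by
  obtain ⟨c, rfl⟩ := CStarAlgebra.nonneg_iff_eq_star_mul_self.1 hb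
  rw [mul_assoc, (CStarRing.star_mul_self_eq_zero_iff (c * y)).1 (by
    rw [star_mul, ← h]; simp only [mul_assoc]), mul_zero]

theorem mul_eq_zero_of_le {a b y : R} (hb : 0 ≤ b) (hba : b ≤ a) (h : a * y = 0) : b * y = 0 := by
  refine mul_eq_zero_of_conj_eq_zero hb (le_antisymm ?_ (star_left_conjugate_nonneg hb y))
  have := star_left_conjugate_le_conjugate hba y
  rwa [mul_assoc _ a, h, mul_zero] at this

theorem IsStarProjection.conjugate_nonneg {p b : R} (hp : IsStarProjection p) (hb : 0 ≤ b) :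
    0 ≤ p * b * p := by
  have := star_left_conjugate_nonneg hb p
  rwa [hp.star_eq] at this

theorem cutoff_nonneg (a : R) (t : ℝ) : 0 ≤ cutoff a t :=
  cfc_nonneg fun _ _ => le_max_right _ _

theorem cutoff_anti (a : R) (h : t ≤ s) : cutoff a s ≤ cutoff a t :=
  cfc_mono (fun x _ => max_le_max (by linarith) le_rfl) (by fun_prop) (by fun_prop)

theorem cutoff_zero (ha : 0 ≤ a) : cutoff a 0 = a := by
  rw [cutoff, cfc_congr (g := id), cfc_id ℝ a]
  intro s hs
  simp [spectrum_nonneg_of_nonneg ha hs]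

theorem cutoff_sub_le (ha : IsSelfAdjoint a) (h : t ≤ s) :
    cutoff a t - cutoff a s ≤ (s - t) • (1 : R) := by
  rw [cutoff, cutoff, ← cfc_sub _ _ a (by fun_prop) (by fun_prop),
    ← Algebra.algebraMap_eq_smul_one]
  refine cfc_le_algebraMap _ _ _ fun x _ => ?_
  rcases le_total x s with hx | hx <;> rcases le_total x t with hx' | hx' <;>
    simp [hx, hx'] <;> linarith

theorem sub_smul_one_le_cutoff (ha : IsSelfAdjoint a) (t : ℝ) : a - t • (1 : R) ≤ cutoff a t := by
  have : a - t • (1 : R) = cfc (fun s : ℝ => s - t) a := by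
    rw [cfc_sub _ _ a (by fun_prop) (by fun_prop), cfc_id' ℝ a, cfc_const t a,
      Algebra.algebraMap_eq_smul_one]
  rw [this]
  exact cfc_mono (fun x _ => le_max_left _ _) (by fun_prop) (by fun_prop)

namespace IsSpectralProj

theorem cutoff_mul_of_le (he : IsSpectralProj a t e) (hts : t ≤ s) :
    cutoff a s * e = cutoff a s := by
  have := mul_eq_zero_of_le (y := 1 - e) (cutoff_nonneg a s) (cutoff_anti a hts)
    (by rw [mul_sub, mul_one, he.cutoff_mul, sub_self])
  rw [mul_sub, mul_one, sub_eq_zero] at this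
  exact this.symm

theorem mul_eq_of_le (he : IsSpectralProj a t e) (hf : IsSpectralProj a s f) (hts : t ≤ s) :
    f * e = f :=
  IsRightSupport.mul_eq_self_of_forall hf fun x hx => by
    rw [Set.mem_singleton_iff.1 hx, he.cutoff_mul_of_le hts]

/-- With `smul_le_cutoff_sub`, this squeezes the slice of `a` between levels `t` and `s` between
multiples of two spectral projections: the layer-cake estimate. -/
theorem cutoff_sub_le_smul (he : IsSpectralProj a t e) (ha : IsSelfAdjoint a) (hts : t ≤ s) :
    cutoff a t - cutoff a s ≤ (s - t) • e := by
  have h1 := star_left_conjugate_le_conjugate (cutoff_sub_le ha hts) e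
  have h2 : (cutoff a t - cutoff a s) * e = cutoff a t - cutoff a s := by
    rw [sub_mul, he.cutoff_mul, he.cutoff_mul_of_le hts]
  have h3 : e * (cutoff a t - cutoff a s) = cutoff a t - cutoff a s := by
    rw [((he.commute_cutoff t).sub_right (he.commute_cutoff s)).eq, h2]
  rwa [he.isStarProjection.star_eq, h3, h2, mul_smul_comm, mul_one, smul_mul_assoc,
    he.isStarProjection.mul_self] at h1

theorem smul_le_cutoff_sub (he : IsSpectralProj a s e) (ha : IsSelfAdjoint a) (hts : t ≤ s) :
    (s - t) • e ≤ cutoff a t - cutoff a s := by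
  have h1 : e * (cutoff a t - cutoff a s) = (s - t) • e := by
    rw [cutoff, cutoff, ← cfc_sub _ _ a (by fun_prop) (by fun_prop)]
    refine he.mul_cfc_eq_smul ha (by fun_prop) fun x _ hx => ?_
    rw [max_eq_left (by linarith), max_eq_left (by linarith)]
    ring
  have h2 := he.isStarProjection.one_sub.conjugate_nonneg (sub_nonneg.2 (cutoff_anti a hts))
  have h3 := ((he.commute_cutoff t).sub_right (he.commute_cutoff s)).eq
  rw [← sub_nonneg]
  convert h2 using 1
  rw [sub_mul, one_mul, h1, mul_sub, mul_one, sub_mul, ← h3, h1, smul_mul_assoc,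
    he.isStarProjection.mul_self, sub_self, sub_zero]

theorem norm_mul_one_sub_le (he : IsSpectralProj a t e) (ha : 0 ≤ a) (ht : 0 ≤ t) :
    ‖a * (1 - e)‖ ≤ t := by
  have h1 : a * (1 - e) = (a - cutoff a t) * (1 - e) := by
    rw [sub_mul, mul_sub (cutoff a t), he.cutoff_mul, mul_one, sub_self, sub_zero]
  have h2 : ‖a - cutoff a t‖ ≤ t := by
    have h3 := cutoff_sub_le ha.isSelfAdjoint ht
    have h4 := cutoff_anti a ht
    rw [cutoff_zero ha] at h3 h4
    rw [CStarAlgebra.norm_le_iff_le_algebraMap _ ht (sub_nonneg.2 h4),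
      Algebra.algebraMap_eq_smul_one]
    simpa using h3
  rw [h1]
  calc _ ≤ ‖a - cutoff a t‖ * ‖1 - e‖ := norm_mul_le _ _
    _ ≤ t * 1 := by
        refine mul_le_mul h2 ?_ (norm_nonneg _) ht
        exact he.isStarProjection.one_sub.norm_le
    _ = t := mul_one t

/-- Off the spectral projection for `(t, ∞)`, `a ≤ t`. -/
theorem conjugate_le (he : IsSpectralProj a t e) (ha : IsSelfAdjoint a) {z : R} (hz : e * z = 0) :
    star z * a * z ≤ t • (star z * z) := by
  have h := star_left_conjugate_le_conjugate (sub_smul_one_le_cutoff ha t) z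
  rw [mul_assoc _ (cutoff a t), (IsRightSupport.mul_eq_zero_iff he z).2 hz, mul_zero, mul_sub,
    sub_mul, mul_smul_comm, mul_one, smul_mul_assoc, sub_nonpos] at h
  exact h

/-- On the spectral projection for `(t, ∞)`, `a > t`. -/
theorem eq_zero_of_conjugate_le (he : IsSpectralProj a t e) (ha : IsSelfAdjoint a) {z : R}
    (hz : e * z = z) (h : star z * a * z ≤ t • (star z * z)) : z = 0 := by
  have h1 : e * (a - t • (1 : R)) = cutoff a t := by
    have h2 : a - t • (1 : R) = cfc (fun s : ℝ => s - t) a := by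
      rw [cfc_sub _ _ a (by fun_prop) (by fun_prop), cfc_id' ℝ a, cfc_const t a,
        Algebra.algebraMap_eq_smul_one]
    rw [← he.cutoff_mul, ← (he.commute_cutoff t).eq, h2, cutoff]
    refine he.mul_cfc_congr (by fun_prop) (by fun_prop) fun s _ hs => ?_
    rw [max_eq_left (by linarith)]
  have h2 : star z * cutoff a t * z = star z * a * z - t • (star z * z) := by
    have h3 : star z * e = star z := by
      conv_rhs => rw [← hz, star_mul, he.isStarProjection.star_eq]
    rw [← h1, ← mul_assoc, h3, mul_sub, sub_mul, mul_smul_comm, mul_one, smul_mul_assoc]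
  have h4 : cutoff a t * z = 0 := by
    refine mul_eq_zero_of_conj_eq_zero (cutoff_nonneg a t) (le_antisymm ?_
      (star_left_conjugate_nonneg (cutoff_nonneg a t) z))
    rw [h2]
    exact sub_nonpos.2 h
  rw [← hz]
  exact (IsRightSupport.mul_eq_zero_iff he z).1 h4

end IsSpectralProj

end Spectral

/-! ### Exhausting a support by spectral projections. -/

section SpectralSequence

variable {R : Type*} [CStarAlgebra R]

/-- Each `e n` is a left multiple of `h`, so it kills what `h` kills. Conversely, if every `e n`
kills `y`, then `‖h * y‖ ≤ ‖h * (1 - e n)‖ * ‖y‖`, which tends to `0`. -/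
theorem IsRightSupport.range_of_approx {h p : R} (hp : IsRightSupport {h} p) {e : ℕ → R}
    (hy : ∀ n, ∃ y, e n = y * h) (hh : ∀ n, ‖h * (1 - e n)‖ ≤ 1 / ((n : ℝ) + 1)) :
    IsRightSupport (Set.range e) p := by
  refine hp.congr fun y => ?_
  simp only [Set.forall_mem_range, Set.mem_singleton_iff, forall_eq]
  refine ⟨fun hey => ?_, fun hhy n => ?_⟩
  · have h1 : ∀ n : ℕ, ‖h * y‖ ≤ 1 / ((n : ℝ) + 1) * ‖y‖ := fun n => by
      have : h * y = h * (1 - e n) * y := by rw [mul_assoc, sub_mul, one_mul, hey n, sub_zero]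
      rw [this]
      exact (norm_mul_le _ _).trans (by gcongr; exact hh n)
    have h2 : Filter.Tendsto (fun n : ℕ => 1 / ((n : ℝ) + 1) * ‖y‖) Filter.atTop (nhds 0) := by
      simpa using tendsto_one_div_add_atTop_nhds_zero_nat.mul_const ‖y‖
    exact norm_le_zero_iff.1 (ge_of_tendsto' h2 h1)
  · obtain ⟨z, hz⟩ := hy n
    rw [hz, mul_assoc, hhy, mul_zero]

variable [PartialOrder R] [StarOrderedRing R]

/-- A positive element of a Baer C*-algebra has an increasing sequence of projections on which it
is invertible and off which it is small. -/
theorem IsBaerStarRing.exists_seq (hR : IsBaerStarRing R) {h : R} (hh : 0 ≤ h) :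
    ∃ e : ℕ → R, (∀ n : ℕ, IsSpectralProj h (1 / ((n : ℝ) + 1)) (e n)) ∧
      (∀ n, e n * e (n + 1) = e n) ∧ (∀ n, ∃ y, e n = y * h) ∧
      ∀ n : ℕ, ‖h * (1 - e n)‖ ≤ 1 / ((n : ℝ) + 1) := by
  choose e he using fun n : ℕ => hR.exists_isSpectralProj h (1 / ((n : ℝ) + 1))
  refine ⟨e, he, fun n => ?_, fun n => ?_, fun n => ?_⟩
  · refine (he (n + 1)).mul_eq_of_le (he n) ?_
    push_cast
    gcongr
    linarith
  · obtain ⟨w, -, -, -, hw⟩ := (he n).exists_inverse (by positivity) hh.isSelfAdjoint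
    exact ⟨w * w * e n, by rw [mul_assoc, ((he n).commute hh.isSelfAdjoint).eq, ← mul_assoc, hw]⟩
  · exact (he n).norm_mul_one_sub_le hh (by positivity)

end SpectralSequence

/-! ### Quasitraces on commuting elements. -/

namespace IsOneQuasitrace

variable {R : Type*} [CStarAlgebra R] {τ : R → ℂ}

/-- The bicommutant of `{a, b}` is a closed commutative `*`-algebra containing both elements. -/
theorem linear_of_commute (hτ : IsOneQuasitrace τ) {a b : R} (ha : IsSelfAdjoint a)
    (hb : IsSelfAdjoint b) (hab : Commute a b) :
    τ (a + b) = τ a + τ b ∧ ∀ c : ℂ, τ (c • a) = c * τ a := by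
  let S : Set R := {a, b}
  have hS : star S = S := by
    ext x
    simp only [S, Set.mem_star, Set.mem_insert_iff, Set.mem_singleton_iff]
    rw [← ha.star_eq, ← hb.star_eq, star_inj, star_inj, ha.star_eq, hb.star_eq]
  let B := NonUnitalStarSubalgebra.centralizer ℂ (NonUnitalStarSubalgebra.centralizer ℂ S : Set R)
  have hB : (B : Set R) = S.centralizer.centralizer := by
    simp only [B]
    rw [NonUnitalStarSubalgebra.coe_centralizer_centralizer, hS, Set.union_self]
  have hmem : ∀ x, x ∈ B ↔ x ∈ S.centralizer.centralizer := fun x => by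
    rw [← hB]; rfl
  have hSS : S ⊆ S.centralizer := by
    rintro x (rfl | rfl) y (rfl | rfl)
    exacts [rfl, hab.eq.symm, hab.eq, rfl]
  have haB : a ∈ B := (hmem a).2 (Set.subset_centralizer_centralizer (by simp [S]))
  have hbB : b ∈ B := (hmem b).2 (Set.subset_centralizer_centralizer (by simp [S]))
  have := hτ.linear_on_abelian B (hB ▸ Set.isClosed_centralizer _) fun x hx y hy => by
    rw [hmem] at hx hy
    exact (hx y (Set.centralizer_subset hSS hy)).symm
  exact ⟨this.1 a haB b hbB, fun c => this.2 c a haB⟩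

theorem map_zero (hτ : IsOneQuasitrace τ) : τ 0 = 0 := by
  simpa using (hτ.linear_of_commute (.zero R) (.zero R) (Commute.refl 0)).2 0

theorem re_add (hτ : IsOneQuasitrace τ) {a b : R} (ha : IsSelfAdjoint a) (hb : IsSelfAdjoint b)
    (hab : Commute a b) : (τ (a + b)).re = (τ a).re + (τ b).re := by
  rw [(hτ.linear_of_commute ha hb hab).1, Complex.add_re]

theorem re_sub (hτ : IsOneQuasitrace τ) {a b : R} (ha : IsSelfAdjoint a) (hb : IsSelfAdjoint b)
    (hab : Commute a b) : (τ (a - b)).re = (τ a).re - (τ b).re := by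
  have := hτ.re_add (ha.sub hb) hb (hab.sub_left (Commute.refl b))
  rw [sub_add_cancel] at this
  linarith

theorem re_smul (hτ : IsOneQuasitrace τ) {a : R} (ha : IsSelfAdjoint a) (c : ℝ) :
    (τ (c • a)).re = c * (τ a).re := by
  have := (hτ.linear_of_commute ha ha (Commute.refl a)).2 c
  rw [← Complex.coe_smul, this, Complex.re_ofReal_mul]

theorem nonneg [PartialOrder R] [StarOrderedRing R] (hτ : IsOneQuasitrace τ) {a : R} (ha : 0 ≤ a) :
    0 ≤ τ a := by
  obtain ⟨x, rfl⟩ := CStarAlgebra.nonneg_iff_eq_star_mul_self.1 ha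
  exact hτ.star_mul_self_nonneg x

theorem re_nonneg [PartialOrder R] [StarOrderedRing R] (hτ : IsOneQuasitrace τ) {a : R}
    (ha : 0 ≤ a) : 0 ≤ (τ a).re :=
  (Complex.nonneg_iff.1 (hτ.nonneg ha)).1

theorem re_mono_of_commute [PartialOrder R] [StarOrderedRing R] (hτ : IsOneQuasitrace τ) {a b : R}
    (ha : IsSelfAdjoint a) (hb : IsSelfAdjoint b) (hab : Commute a b) (h : a ≤ b) :
    (τ a).re ≤ (τ b).re := by
  have := hτ.re_nonneg (sub_nonneg.2 h)
  rw [hτ.re_sub hb ha hab.symm] at this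
  linarith

theorem re_nonneg_of_isStarProjection (hτ : IsOneQuasitrace τ) {p : R} (hp : IsStarProjection p) :
    0 ≤ (τ p).re := by
  rw [← hp.mul_self]
  nth_rw 1 [← hp.star_eq]
  exact (Complex.nonneg_iff.1 (hτ.star_mul_self_nonneg p)).1

theorem re_sub_of_mul_eq (hτ : IsOneQuasitrace τ) {p q : R} (hp : IsStarProjection p)
    (hq : IsStarProjection q) (h : p * q = p) : (τ (q - p)).re = (τ q).re - (τ p).re :=
  hτ.re_sub hq.isSelfAdjoint hp.isSelfAdjoint
    (by rw [Commute, SemiconjBy, h, hp.mul_eq_left_comm hq h])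

theorem re_le_of_mul_eq (hτ : IsOneQuasitrace τ) {p q : R} (hp : IsStarProjection p)
    (hq : IsStarProjection q) (h : p * q = p) : (τ p).re ≤ (τ q).re := by
  have := hτ.re_nonneg_of_isStarProjection (hp.sub_of_mul_eq_left hq h)
  rw [hτ.re_sub_of_mul_eq hp hq h] at this
  linarith

end IsOneQuasitrace

/-! ### Normality along sequences of projections. -/

section Normal

variable {R : Type*} [CStarAlgebra R] {τ : R → ℂ}

/-- Normality is indexed by a set, so repetitions matter; an orthogonal sequence of projections can
only repeat `0`, which contributes nothing. -/
theorem IsNormalQuasitrace.hasSum_nat (hn : IsNormalQuasitrace τ) (hτ : IsOneQuasitrace τ)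
    {d : ℕ → R} (hd : ∀ n, IsStarProjection (d n)) (ho : ∀ m n, m ≠ n → d m * d n = 0) {p : R}
    (hp : IsProjectionSup (Set.range d) p) : HasSum (fun n => τ (d n)) (τ p) := by
  have h1 := hn (Set.range d) ⟨by rintro _ ⟨n, rfl⟩; exact hd n, by
    rintro _ ⟨m, rfl⟩ _ ⟨n, rfl⟩ hmn
    exact ho m n fun h => hmn (by rw [h])⟩ p hp
  refine (hasSum_iff_hasSum_of_ne_zero_bij (fun n => ⟨d n, Set.mem_range_self _⟩) ?_ ?_ ?_).1 h1
  · rintro ⟨m, hm⟩ ⟨n, hn⟩ hmn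
    have hmn : d m = d n := congrArg Subtype.val hmn
    by_contra hne
    have := ho m n fun h => hne (by simp [h])
    rw [← hmn, (hd m).mul_self] at this
    exact hm (by simp [this, hτ.map_zero])
  · rintro ⟨_, n, rfl⟩ hs
    exact ⟨⟨n, hs⟩, rfl⟩
  · intro x; rfl

/-- The successive differences of an increasing sequence of projections. -/
def projDiff (e : ℕ → R) : ℕ → R
  | 0 => e 0
  | k + 1 => e (k + 1) - e k

theorem isStarProjection_projDiff {e : ℕ → R} (he : ∀ n, IsStarProjection (e n))
    (hmono : ∀ n, e n * e (n + 1) = e n) (n : ℕ) : IsStarProjection (projDiff e n) := by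
  cases n with
  | zero => exact he 0
  | succ k => exact (he k).sub_of_mul_eq_left (he _) (hmono k)

theorem projDiff_mul_eq_zero {e : ℕ → R} (he : ∀ n, IsStarProjection (e n))
    (hmono : ∀ n, e n * e (n + 1) = e n) (m n : ℕ) (hmn : m ≠ n) :
    projDiff e m * projDiff e n = 0 := by
  have hle : ∀ m n, m ≤ n → e m * e n = e m := fun m n hmn => by
    induction n, hmn using Nat.le_induction with
    | base => exact (he m).mul_self
    | succ n _ ih => rw [← ih, mul_assoc, hmono]
  have hde : ∀ n, projDiff e n * e n = projDiff e n := fun n => by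
    cases n with
    | zero => exact (he 0).mul_self
    | succ k => simp only [projDiff, sub_mul, (he _).mul_self, hmono]
  have hlt : ∀ m n, m < n → projDiff e m * projDiff e n = 0 := fun m n hmn => by
    have hed : e m * projDiff e n = 0 := by
      cases n with
      | zero => omega
      | succ k =>
        rw [projDiff, mul_sub, hle m _ (by omega), hle m _ (by omega), sub_self]
    rw [← hde m, mul_assoc, hed, mul_zero]
  rcases hmn.lt_or_gt with h | h
  · exact hlt m n h
  · exact (isStarProjection_projDiff he hmono n).mul_eq_zero_comm
      (isStarProjection_projDiff he hmono m) (hlt n m h)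

theorem IsRightSupport.range_projDiff {e : ℕ → R} {p : R}
    (hp : IsRightSupport (Set.range e) p) : IsRightSupport (Set.range (projDiff e)) p :=
  hp.congr fun y => by
    simp only [Set.forall_mem_range]
    refine ⟨fun h n => ?_, fun h n => ?_⟩
    · induction n with
      | zero => exact h 0
      | succ k ih =>
        have := h (k + 1)
        rwa [projDiff, sub_mul, ih, sub_zero] at this
    · cases n with
      | zero => exact h 0
      | succ k => rw [projDiff, sub_mul, h, h, sub_zero]

theorem IsNormalQuasitrace.tendsto_re (hn : IsNormalQuasitrace τ) (hτ : IsOneQuasitrace τ)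
    {e : ℕ → R} (he : ∀ n, IsStarProjection (e n)) (hmono : ∀ n, e n * e (n + 1) = e n) {p : R}
    (hp : IsRightSupport (Set.range e) p) :
    Filter.Tendsto (fun n => (τ (e n)).re) Filter.atTop (nhds (τ p).re) := by
  have h1 := (hn.hasSum_nat hτ (isStarProjection_projDiff he hmono)
    (projDiff_mul_eq_zero he hmono) hp.range_projDiff.isProjectionSup).tendsto_sum_nat
  -- The index is shifted because the first `n + 1` differences sum to `e n`.
  have h2 := (Complex.continuous_re.tendsto _).comp ((Filter.tendsto_add_atTop_iff_nat 1).2 h1)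
  refine h2.congr fun n => ?_
  simp only [Function.comp_apply]
  induction n with
  | zero => simp [projDiff]
  | succ k ih =>
    rw [Finset.sum_range_succ, Complex.add_re, ih, projDiff,
      hτ.re_sub_of_mul_eq (he k) (he _) (hmono k)]
    ring

end Normal

/-! ### Comparison of projections and quasi-additivity on positive elements. -/

section Comparison

variable {R : Type*} [CStarAlgebra R] {τ : R → ℂ}

theorem IsOneQuasitrace.re_le_of_partialIsometry (hτ : IsOneQuasitrace τ) {v e q : R}
    (he : IsStarProjection e) (hq : IsStarProjection q) (hv : star v * v = e) (hqv : q * v = v) :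
    (τ e).re ≤ (τ q).re := by
  have h1 : v * e = v := by
    have h2 : star (v - v * e) * (v - v * e) = 0 := by
      simp only [star_sub, star_mul, he.star_eq, sub_mul, mul_sub]
      rw [← mul_assoc _ v e, mul_assoc e _ v, mul_assoc e _ (v * e), ← mul_assoc _ v e, hv]
      simp [he.mul_self]
    exact (sub_eq_zero.1 ((CStarRing.star_mul_self_eq_zero_iff _).1 h2)).symm
  have h3 : IsStarProjection (v * star v) :=
    ⟨by rw [IsIdempotentElem, mul_assoc, ← mul_assoc _ v, hv, ← mul_assoc, h1],
      .mul_star_self v⟩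
  rw [← hv, hτ.star_mul_self_comm]
  exact hτ.re_le_of_mul_eq h3 hq (h3.mul_eq_right_comm hq (by rw [← mul_assoc, hqv]))

variable [PartialOrder R] [StarOrderedRing R]

/-- The right support of `x` is dominated by any projection `q` with `q x = x`. -/
theorem re_support_le (hR : IsBaerStarRing R) (hτ : IsOneQuasitrace τ) (hn : IsNormalQuasitrace τ)
    {x p q : R} (hp : IsRightSupport {x} p) (hq : IsStarProjection q) (hqx : q * x = x) :
    (τ p).re ≤ (τ q).re := by
  obtain ⟨e, he, hmono, hy, hh⟩ := hR.exists_seq (star_mul_self_nonneg x)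
  have hlim := hn.tendsto_re hτ (fun n => (he n).isStarProjection) hmono
    ((IsRightSupport.star_mul_self_iff.2 hp).range_of_approx hy hh)
  -- In place of a polar decomposition of `x`: on each `e n` the element `star x * x` is invertible,
  -- so `x * w * e n` is a partial isometry from `e n` into `q`.
  refine le_of_tendsto' hlim fun n => ?_
  have hsa : IsSelfAdjoint (star x * x) := .star_mul_self x
  obtain ⟨w, hw, hwe, hwh, hwi⟩ := (he n).exists_inverse (by positivity) hsa
  refine hτ.re_le_of_partialIsometry (v := x * w * e n) (he n).isStarProjection hq ?_
    (by rw [← mul_assoc, ← mul_assoc, hqx])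
  calc star (x * w * e n) * (x * w * e n) = e n * (w * (star x * x * w) * e n) := by
        simp only [star_mul, hw.star_eq, (he n).isStarProjection.star_eq, mul_assoc]
    _ = e n * (w * w * (star x * x) * e n) := by rw [← hwh.eq, ← mul_assoc w]
    _ = e n := by rw [hwi, (he n).isStarProjection.mul_self]

/-- If `f` meets `1 - q` trivially, then `f` is the right support of `q * f`, whose range lies under
`q`. -/
theorem re_le_of_disjoint (hR : IsBaerStarRing R) (hτ : IsOneQuasitrace τ)
    (hn : IsNormalQuasitrace τ) {f q : R} (hf : IsStarProjection f) (hq : IsStarProjection q)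
    (h : ∀ z, f * z = z → q * z = 0 → z = 0) : (τ f).re ≤ (τ q).re := by
  refine re_support_le hR hτ hn (x := q * f) ⟨hf, fun y => ?_⟩ hq
    (by rw [← mul_assoc, hq.mul_self])
  simp only [Set.mem_singleton_iff, forall_eq]
  refine ⟨fun hy => h _ (by rw [← mul_assoc, hf.mul_self]) (by rw [← mul_assoc, hy]), fun hy => ?_⟩
  rw [mul_assoc, hy, mul_zero]

theorem re_sup_pair_le (hR : IsBaerStarRing R) (hτ : IsOneQuasitrace τ)
    (hn : IsNormalQuasitrace τ) {e f q : R} (he : IsStarProjection e) (hf : IsStarProjection f)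
    (hq : IsRightSupport {e, f} q) : (τ q).re ≤ (τ e).re + (τ f).re := by
  have heq : e * q = e := hq.mul_eq (by simp)
  have h1 := hτ.re_sub_of_mul_eq he hq.isStarProjection heq
  have h2 : (τ (q - e)).re ≤ (τ f).re := by
    refine re_le_of_disjoint hR hτ hn (he.sub_of_mul_eq_left hq.isStarProjection heq) hf
      fun z hz hfz => ?_
    have hez : e * z = 0 := by
      rw [← hz, ← mul_assoc, mul_sub, heq, he.mul_self, sub_self, zero_mul]
    have hqz : q * z = 0 := (hq.iff z).1 (by simp [hez, hfz])
    rw [← hz, sub_mul, hqz, hez, sub_zero]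
  linarith

theorem re_sup_range_le (hR : IsBaerStarRing R) (hτ : IsOneQuasitrace τ)
    (hn : IsNormalQuasitrace τ) {e : ℕ → R} (he : ∀ n, IsStarProjection (e n)) {q : R}
    (hq : IsRightSupport (Set.range e) q) {c : ℝ}
    (hc : ∀ n, ∑ i ∈ Finset.range n, (τ (e i)).re ≤ c) : (τ q).re ≤ c := by
  -- `s n` is the supremum of the first `n` projections, so `s 0` is the support of the empty set.
  choose s hs using fun n : ℕ => hR.exists_isRightSupport (e '' Set.Iio n)
  have h0 : s 0 = 0 := by
    have := ((hs 0).iff 1).1 (by simp)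
    simpa using this
  have hle : ∀ n, (τ (s n)).re ≤ ∑ i ∈ Finset.range n, (τ (e i)).re := fun n => by
    induction n with
    | zero => simp [h0, hτ.map_zero]
    | succ k ih =>
      rw [Finset.sum_range_succ]
      refine (re_sup_pair_le hR hτ hn (hs k).isStarProjection (he k)
        ((hs (k + 1)).congr fun y => ?_)).trans (by linarith)
      simp only [Set.mem_insert_iff, Set.mem_singleton_iff, forall_eq, ← (hs k).iff, Set.forall_mem_image, Set.mem_Iio, Nat.lt_succ_iff_lt_or_eq, or_imp,
        forall_and]
  refine le_of_tendsto' (hn.tendsto_re hτ (fun n => (hs n).isStarProjection) (fun n => ?_)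
    (hq.congr fun y => ?_)) fun n => (hle n).trans (hc n)
  · refine (hs n).mul_eq_self_of_forall fun x hx => (hs (n + 1)).mul_eq ?_
    exact Set.image_mono (Set.Iio_subset_Iio n.le_succ) hx
  · simp only [Set.forall_mem_range, ← (hs _).iff, Set.forall_mem_image, Set.mem_Iio]
    exact ⟨fun h n => h (n + 1) n.lt_succ_self, fun h n i _ => h i⟩

/-- Upper and lower Riemann sums for the layer-cake integral of `a`. Everything in sight commutes,
so `τ` is additive and monotone here. -/
theorem IsSpectralProj.re_le_sum (hτ : IsOneQuasitrace τ) {a : R} (ha : 0 ≤ a) {δ : ℝ} (hδ : 0 ≤ δ)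
    {e : ℕ → R} (he : ∀ k : ℕ, IsSpectralProj a (k * δ) (e k)) {N : ℕ} (hN : ‖a‖ ≤ N * δ) :
    (τ a).re ≤ δ * ∑ k ∈ Finset.range N, (τ (e k)).re ∧
      δ * ∑ k ∈ Finset.range N, (τ (e (k + 1))).re ≤ (τ a).re := by
  have hsa := ha.isSelfAdjoint
  have htel : (τ a).re = ∑ k ∈ Finset.range N,
      (τ (cutoff a (k * δ) - cutoff a ((k + 1 : ℕ) * δ))).re := by
    have h1 := Finset.sum_range_sub' (fun k : ℕ => (τ (cutoff a (k * δ))).re) N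
    rw [cutoff_eq_zero hN, hτ.map_zero] at h1
    simp only [Nat.cast_zero, zero_mul, cutoff_zero ha, Complex.zero_re, sub_zero] at h1
    rw [← h1]
    refine Finset.sum_congr rfl fun k _ => ?_
    rw [hτ.re_sub (isSelfAdjoint_cutoff _ _) (isSelfAdjoint_cutoff _ _) (cfc_commute_cfc _ _ _)]
  have hδk : ∀ k : ℕ, (k : ℝ) * δ ≤ (k + 1 : ℕ) * δ := fun k => by
    push_cast; linarith
  have hd : ∀ k : ℕ, ((k + 1 : ℕ) : ℝ) * δ - k * δ = δ := fun k => by push_cast; ring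
  have hsk : ∀ k : ℕ, IsSelfAdjoint (cutoff a (k * δ) - cutoff a ((k + 1 : ℕ) * δ)) := fun k =>
    (isSelfAdjoint_cutoff _ _).sub (isSelfAdjoint_cutoff _ _)
  have hse : ∀ k, IsSelfAdjoint (δ • e k) := fun k =>
    (IsSelfAdjoint.all δ).smul (he k).isStarProjection.isSelfAdjoint
  have hcom : ∀ k j : ℕ, Commute (δ • e j) (cutoff a (k * δ) - cutoff a ((k + 1 : ℕ) * δ)) :=
    fun k j => (((he j).commute_cutoff _).sub_right ((he j).commute_cutoff _)).smul_left δ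
  rw [htel, Finset.mul_sum, Finset.mul_sum]
  refine ⟨Finset.sum_le_sum fun k _ => ?_, Finset.sum_le_sum fun k _ => ?_⟩
  · rw [← hτ.re_smul (he k).isStarProjection.isSelfAdjoint]
    refine hτ.re_mono_of_commute (hsk k) (hse k) (hcom k k).symm ?_
    have := (he k).cutoff_sub_le_smul hsa (hδk k)
    rwa [hd] at this
  · rw [← hτ.re_smul (he (k + 1)).isStarProjection.isSelfAdjoint]
    refine hτ.re_mono_of_commute (hse _) (hsk k) (hcom k (k + 1)) ?_
    have := (he (k + 1)).smul_le_cutoff_sub hsa (hδk k)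
    rwa [hd] at this

/-- Spectral comparison: the part of `c ≤ a + b` above `2 t` is controlled by the parts of `a` and
`b` above `t`. -/
theorem IsSpectralProj.re_le_add (hR : IsBaerStarRing R) (hτ : IsOneQuasitrace τ)
    (hn : IsNormalQuasitrace τ) {a b c e f g : R} (ha : IsSelfAdjoint a) (hb : IsSelfAdjoint b)
    (hc : IsSelfAdjoint c) (h : c ≤ a + b) {t : ℝ} (he : IsSpectralProj a t e)
    (hf : IsSpectralProj b t f) (hg : IsSpectralProj c (2 * t) g) :
    (τ g).re ≤ (τ e).re + (τ f).re := by
  obtain ⟨q, hq⟩ := hR.exists_isRightSupport {e, f}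
  refine le_trans ?_ (re_sup_pair_le hR hτ hn he.isStarProjection hf.isStarProjection hq)
  -- A vector under `g` and killed by `e` and `f` would see `c` both above and at most `2 * t`.
  refine re_le_of_disjoint hR hτ hn hg.isStarProjection hq.isStarProjection fun z hz hqz => ?_
  have h1 := (hq.iff z).2 hqz
  refine hg.eq_zero_of_conjugate_le hc hz ?_
  calc star z * c * z ≤ star z * (a + b) * z := star_left_conjugate_le_conjugate h z
    _ = star z * a * z + star z * b * z := by rw [mul_add, add_mul]
    _ ≤ t • (star z * z) + t • (star z * z) :=
        add_le_add (he.conjugate_le ha (h1 e (by simp))) (hf.conjugate_le hb (h1 f (by simp)))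
    _ = (2 * t) • (star z * z) := by rw [← add_smul, two_mul]

/-- The upper sum of `c` with mesh `2 * δ` is compared with the lower sums of `a` and `b` with mesh
`δ`. The doubled levels produce the factor `2`. -/
theorem re_le_two_mul_add (hR : IsBaerStarRing R) (hτ : IsOneQuasitrace τ)
    (hn : IsNormalQuasitrace τ) {a b c : R} (ha : 0 ≤ a) (hb : 0 ≤ b) (hc : 0 ≤ c)
    (h : c ≤ a + b) : (τ c).re ≤ 2 * ((τ a).re + (τ b).re) := by
  have h1 : 0 ≤ (τ 1).re := hτ.re_nonneg_of_isStarProjection (.one R)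
  refine le_of_forall_pos_le_add fun ε hε => ?_
  -- Passing from upper to lower sums costs `τ 1` for each of `a` and `b`, weighted by `2 * δ`.
  obtain ⟨δ, hδ, hδε⟩ : ∃ δ : ℝ, 0 < δ ∧ 4 * δ * (τ 1).re ≤ ε := by
    refine ⟨ε / (4 * ((τ 1).re + 1)), by positivity, ?_⟩
    rw [mul_div_assoc', div_mul_eq_mul_div, div_le_iff₀ (by positivity)]
    nlinarith
  choose e he using fun k : ℕ => hR.exists_isSpectralProj a (k * δ)
  choose f hf using fun k : ℕ => hR.exists_isSpectralProj b (k * δ)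
  choose g hg using fun k : ℕ => hR.exists_isSpectralProj c (k * (2 * δ))
  obtain ⟨N, hN⟩ := exists_nat_ge ((‖a‖ + ‖b‖ + ‖c‖) / δ)
  rw [div_le_iff₀ hδ] at hN
  have hNa := (IsSpectralProj.re_le_sum hτ ha hδ.le he (N := N)
    (by linarith [norm_nonneg b, norm_nonneg c])).2
  have hNb := (IsSpectralProj.re_le_sum hτ hb hδ.le hf (N := N)
    (by linarith [norm_nonneg a, norm_nonneg c])).2
  have hNc := (IsSpectralProj.re_le_sum hτ hc (by positivity) hg (N := N)
    (by linarith [norm_nonneg a, norm_nonneg b, norm_nonneg c])).1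
  have hgk : ∀ k, (τ (g k)).re ≤ (τ (e k)).re + (τ (f k)).re := fun k =>
    IsSpectralProj.re_le_add hR hτ hn ha.isSelfAdjoint hb.isSelfAdjoint hc.isSelfAdjoint h (he k)
      (hf k) (by have := hg k; rwa [mul_left_comm] at this)
  have hshift : ∀ {e : ℕ → R}, (∀ k, IsStarProjection (e k)) → ∑ k ∈ Finset.range N, (τ (e k)).re ≤
      (τ 1).re + ∑ k ∈ Finset.range N, (τ (e (k + 1))).re := fun {e} he => by
    have h2 := Finset.sum_range_succ (fun k => (τ (e k)).re) N
    rw [Finset.sum_range_succ'] at h2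
    have h3 := hτ.re_nonneg_of_isStarProjection (he N)
    have h4 := hτ.re_le_of_mul_eq (he 0) (.one R) (mul_one _)
    linarith
  have hsum : ∑ k ∈ Finset.range N, (τ (g k)).re ≤ ∑ k ∈ Finset.range N, (τ (e k)).re +
      ∑ k ∈ Finset.range N, (τ (f k)).re := by
    rw [← Finset.sum_add_distrib]
    exact Finset.sum_le_sum fun k _ => hgk k
  have h5 := hshift fun k => (he k).isStarProjection
  have h6 := hshift fun k => (hf k).isStarProjection
  have h7 := mul_le_mul_of_nonneg_left (hsum.trans (add_le_add h5 h6)) (by positivity : 0 ≤ 2 * δ)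
  linarith

end Comparison

/-! ### The `2`-norm as a quasi-norm, and closures with respect to it. -/

section TwoNorm

variable {M : Type*} [CStarAlgebra M]

/-- The properties of a quasitrace on an `AW*`-algebra which make the closure in the `2`-norm
well behaved. -/
structure IsFaithfulNormal (τ : M → ℂ) : Prop where
  baer : IsBaerStarRing M
  quasi : IsOneQuasitrace τ
  normal : IsNormalQuasitrace τ
  faithful : IsFaithfulQuasitrace τ

/-- The square `τ(x* x)` of the `2`-norm. -/
noncomputable def sqNormTwo (τ : M → ℂ) (x : M) : ℝ := (τ (star x * x)).re

variable {τ : M → ℂ}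

theorem mem_quasiClosure_iff {s : Set M} {x : M} :
    x ∈ quasiClosure τ s ↔ ∀ ε : ℝ, 0 < ε → ∃ a ∈ s, sqNormTwo τ (x - a) < ε := by
  have h : ∀ ε : ℝ, 0 < ε → ∀ a, quasiDist τ x a < (√ε) ^ (2 / 3 : ℝ) ↔ sqNormTwo τ (x - a) < ε := by
    intro ε hε a
    rw [quasiDist, quasiNormTwo,
      Real.rpow_lt_rpow_iff (Real.sqrt_nonneg _) (Real.sqrt_nonneg _) (by norm_num), Real.sqrt_lt_sqrt_iff_of_pos hε, sqNormTwo]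
  refine ⟨fun hx ε hε => ?_, fun hx ε hε => ?_⟩
  · obtain ⟨a, ha, hxa⟩ := hx ((√ε) ^ (2 / 3 : ℝ)) (by positivity)
    exact ⟨a, ha, (h ε hε a).1 hxa⟩
  · obtain ⟨a, ha, hxa⟩ := hx ((ε ^ (3 / 2 : ℝ)) ^ 2) (by positivity)
    refine ⟨a, ha, ?_⟩
    have := (h _ (by positivity) a).2 hxa
    rwa [Real.sqrt_sq (by positivity), ← Real.rpow_mul hε.le,
      show (3 / 2 : ℝ) * (2 / 3) = 1 by norm_num, Real.rpow_one] at this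

theorem sqNormTwo_sub_comm (x y : M) : sqNormTwo τ (x - y) = sqNormTwo τ (y - x) := by
  rw [sqNormTwo, sqNormTwo, ← neg_sub y x, star_neg, neg_mul_neg]

namespace IsOneQuasitrace

variable (hτ : IsOneQuasitrace τ)
include hτ

theorem sqNormTwo_nonneg (x : M) : 0 ≤ sqNormTwo τ x :=
  (Complex.nonneg_iff.1 (hτ.star_mul_self_nonneg x)).1

theorem sqNormTwo_star (x : M) : sqNormTwo τ (star x) = sqNormTwo τ x := by
  rw [sqNormTwo, sqNormTwo, hτ.star_mul_self_comm x, star_star]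

theorem sqNormTwo_zero : sqNormTwo τ 0 = 0 := by
  simp [sqNormTwo, hτ.map_zero]

theorem sqNormTwo_sub_of_mul_eq {p q : M} (hp : IsStarProjection p) (hq : IsStarProjection q)
    (h : p * q = p) : sqNormTwo τ (q - p) = (τ q).re - (τ p).re := by
  have h1 := hp.sub_of_mul_eq_left hq h
  rw [sqNormTwo, h1.star_eq, h1.mul_self, hτ.re_sub_of_mul_eq hp hq h]

theorem subset_quasiClosure (s : Set M) : s ⊆ quasiClosure τ s := fun x hx =>
  mem_quasiClosure_iff.2 fun ε hε => ⟨x, hx, by rwa [sub_self, hτ.sqNormTwo_zero]⟩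

end IsOneQuasitrace

theorem quasiClosure_mono {s t : Set M} (h : s ⊆ t) : quasiClosure τ s ⊆ quasiClosure τ t :=
  fun _ hx ε hε => (hx ε hε).imp fun _ ha => ⟨h ha.1, ha.2⟩

namespace IsFaithfulNormal

variable (hτ : IsFaithfulNormal τ)
include hτ

theorem eq_zero_of_sqNormTwo {x : M} (hx : sqNormTwo τ x = 0) : x = 0 :=
  hτ.faithful x (Complex.ext hx (Complex.nonneg_iff.1 (hτ.quasi.star_mul_self_nonneg x)).2.symm)

section Order

variable [PartialOrder M] [StarOrderedRing M]

/-- Without commutation, monotonicity is obtained only up to the constant of `re_le_two_mul_add`,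
with second summand `0`. -/
theorem re_le_two_mul {a c : M} (hc : 0 ≤ c) (h : c ≤ a) : (τ c).re ≤ 2 * (τ a).re := by
  have := re_le_two_mul_add hτ.baer hτ.quasi hτ.normal (hc.trans h) le_rfl hc
    (h.trans_eq (add_zero a).symm)
  simpa [hτ.quasi.map_zero] using this

end Order

theorem sqNormTwo_add_le (x y : M) :
    sqNormTwo τ (x + y) ≤ 4 * (sqNormTwo τ x + sqNormTwo τ y) := by
  let _ := CStarAlgebra.spectralOrder M
  have := CStarAlgebra.spectralOrderedRing M
  have h1 : star (x + y) * (x + y) ≤ (2 : ℝ) • (star x * x) + (2 : ℝ) • (star y * y) := by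
    -- The parallelogram identity.
    have h2 : (2 : ℝ) • (star x * x) + (2 : ℝ) • (star y * y) - star (x + y) * (x + y) =
        star (x - y) * (x - y) := by
      simp only [two_smul, star_add, star_sub, add_mul, mul_add, sub_mul, mul_sub]
      abel
    rw [← sub_nonneg, h2]
    exact star_mul_self_nonneg _
  have h3 := re_le_two_mul_add hτ.baer hτ.quasi hτ.normal
    (smul_nonneg zero_le_two (star_mul_self_nonneg x))
    (smul_nonneg zero_le_two (star_mul_self_nonneg y)) (star_mul_self_nonneg _) h1
  rw [hτ.quasi.re_smul (.star_mul_self x), hτ.quasi.re_smul (.star_mul_self y)] at h3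
  rw [sqNormTwo, sqNormTwo, sqNormTwo]
  linarith

theorem sqNormTwo_sub_le (x y z : M) :
    sqNormTwo τ (x - z) ≤ 4 * (sqNormTwo τ (x - y) + sqNormTwo τ (y - z)) := by
  rw [← sub_add_sub_cancel x y z]
  exact hτ.sqNormTwo_add_le _ _

theorem sqNormTwo_mul_left_le (a x : M) :
    sqNormTwo τ (a * x) ≤ 2 * ‖a‖ ^ 2 * sqNormTwo τ x := by
  let _ := CStarAlgebra.spectralOrder M
  have := CStarAlgebra.spectralOrderedRing M
  have h1 : star (a * x) * (a * x) ≤ (‖a‖ ^ 2) • (star x * x) := by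
    have := CStarAlgebra.star_left_conjugate_le_norm_smul (a := x) (b := star a * a)
      (.star_mul_self a)
    rw [CStarRing.norm_star_mul_self, ← sq] at this
    simpa only [star_mul, mul_assoc] using this
  have h2 := hτ.re_le_two_mul (star_mul_self_nonneg _) h1
  rw [hτ.quasi.re_smul (.star_mul_self x)] at h2
  rw [sqNormTwo, sqNormTwo]
  linarith

theorem sqNormTwo_mul_right_le (x a : M) :
    sqNormTwo τ (x * a) ≤ 2 * ‖a‖ ^ 2 * sqNormTwo τ x := by
  rw [← hτ.quasi.sqNormTwo_star, ← hτ.quasi.sqNormTwo_star x, star_mul, ← norm_star a]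
  exact hτ.sqNormTwo_mul_left_le _ _

theorem sqNormTwo_le_norm (x : M) : sqNormTwo τ x ≤ 2 * ‖x‖ ^ 2 * (τ 1).re := by
  have := hτ.sqNormTwo_mul_left_le x 1
  rwa [mul_one, sqNormTwo, sqNormTwo, star_one, mul_one] at this

theorem quasiClosure_quasiClosure_subset (s : Set M) :
    quasiClosure τ (quasiClosure τ s) ⊆ quasiClosure τ s := fun x hx => by
  rw [mem_quasiClosure_iff] at hx ⊢
  intro ε hε
  obtain ⟨y, hy, hxy⟩ := hx (ε / 8) (by positivity)
  obtain ⟨z, hz, hyz⟩ := mem_quasiClosure_iff.1 hy (ε / 8) (by positivity)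
  exact ⟨z, hz, by linarith [hτ.sqNormTwo_sub_le x y z]⟩

/-- Maps which are continuous in the `2`-norm preserve closures. -/
theorem map_mem_quasiClosure {s t : Set M} {f : M → M} {c : ℝ}
    (hc : ∀ x y, sqNormTwo τ (f x - f y) ≤ c * sqNormTwo τ (x - y))
    (hf : ∀ x ∈ s, f x ∈ quasiClosure τ t) {x : M} (hx : x ∈ quasiClosure τ s) :
    f x ∈ quasiClosure τ t := by
  refine hτ.quasiClosure_quasiClosure_subset t (mem_quasiClosure_iff.2 fun ε hε => ?_)
  obtain ⟨y, hy, hxy⟩ := mem_quasiClosure_iff.1 hx (ε / (|c| + 1)) (by positivity)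
  refine ⟨f y, hf y hy, (hc x y).trans_lt ?_⟩
  have h0 := hτ.quasi.sqNormTwo_nonneg (x - y)
  rw [lt_div_iff₀ (by positivity)] at hxy
  nlinarith [le_abs_self c]

/-- The closure of a `*`-subalgebra in the `2`-norm. -/
def quasiClosureSubalgebra (A : StarSubalgebra ℂ M) : StarSubalgebra ℂ M where
  carrier := quasiClosure τ (A : Set M)
  mul_mem' {x y} hx hy := by
    -- One factor is approximated at a time, since the continuity constant depends on the operator
    -- norm of the fixed factor.
    refine hτ.map_mem_quasiClosure (f := fun x => x * y) (c := 2 * ‖y‖ ^ 2) (fun u v => ?_)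
      (fun a ha => ?_) hx
    · rw [← sub_mul]; exact hτ.sqNormTwo_mul_right_le _ _
    · refine hτ.map_mem_quasiClosure (f := fun y => a * y) (c := 2 * ‖a‖ ^ 2) (fun u v => ?_)
        (fun b hb => hτ.quasi.subset_quasiClosure _ (A.mul_mem ha hb)) hy
      rw [← mul_sub]; exact hτ.sqNormTwo_mul_left_le _ _
  add_mem' {x y} hx hy := by
    refine hτ.map_mem_quasiClosure (f := fun x => x + y) (c := 1) (fun u v => by simp)
      (fun a ha => ?_) hx
    exact hτ.map_mem_quasiClosure (f := fun y => a + y) (c := 1) (fun u v => by simp)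
        (fun b hb => hτ.quasi.subset_quasiClosure _ (A.add_mem ha hb)) hy
  algebraMap_mem' r := hτ.quasi.subset_quasiClosure _ (A.algebraMap_mem r)
  star_mem' {x} hx := by
    refine hτ.map_mem_quasiClosure (f := star) (c := 1) (fun u v => ?_)
      (fun a ha => hτ.quasi.subset_quasiClosure _ (star_mem ha)) hx
    rw [← star_sub, hτ.quasi.sqNormTwo_star, one_mul]

theorem isClosed_of_quasiClosure_subset {s : Set M} (hs : quasiClosure τ s ⊆ s) : IsClosed s := by
  refine isClosed_of_closure_subset fun x hx => hs (mem_quasiClosure_iff.2 fun ε hε => ?_)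
  have h1 := hτ.quasi.re_nonneg_of_isStarProjection (.one M)
  obtain ⟨y, hy, hxy⟩ := Metric.mem_closure_iff.1 hx (√(ε / (2 * (τ 1).re + 1))) (by positivity)
  refine ⟨y, hy, (hτ.sqNormTwo_le_norm _).trans_lt ?_⟩
  rw [dist_eq_norm] at hxy
  have h2 := Real.lt_sq_of_sqrt_lt (x := ‖x - y‖ ^ 2) (y := √(ε / (2 * (τ 1).re + 1)))
    (by rwa [Real.sqrt_sq (norm_nonneg _)])
  rw [Real.sq_sqrt (by positivity), lt_div_iff₀ (by positivity)] at h2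
  nlinarith [sq_nonneg ‖x - y‖]

end IsFaithfulNormal

end TwoNorm

/-! ### `2`-norm closed subalgebras are `AW*`-subalgebras. -/

section Subalgebra

variable {M : Type*} [CStarAlgebra M]

/-- If a `*`-subalgebra contains the right supports of its elements and the suprema of its
orthogonal sets of projections, then it contains the right supports of all its subsets. -/
theorem StarSubalgebra.support_set_mem (hM : IsBaerStarRing M) {D : StarSubalgebra ℂ M}
    (hsupp : ∀ x ∈ D, ∀ p, IsRightSupport {x} p → p ∈ D)
    (hsup : ∀ S : Set M, S ⊆ (D : Set M) → IsOrthogonalProjectionSet S →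
      ∀ p : M, IsProjectionSup S p → p ∈ D)
    {S : Set M} (hS : S ⊆ (D : Set M)) {p : M} (hp : IsRightSupport S p) : p ∈ D := by
  obtain ⟨O, hO⟩ := zorn_subset
    {O : Set M | O ⊆ (D : Set M) ∧ IsOrthogonalProjectionSet O ∧ ∀ o ∈ O, o * p = o} (by
      intro c hc hchain
      refine ⟨⋃₀ c, ⟨Set.sUnion_subset fun O hO => (hc hO).1, ⟨?_, ?_⟩, ?_⟩,
        fun O hO => Set.subset_sUnion_of_mem hO⟩
      · rintro s ⟨O, hO, hs⟩
        exact (hc hO).2.1.isStarProjection s hs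
      · rintro s ⟨O, hO, hs⟩ t ⟨O', hO', ht⟩ hst
        rcases hchain.total hO hO' with h | h
        · exact (hc hO').2.1.orthogonal s (h hs) t ht hst
        · exact (hc hO).2.1.orthogonal s hs t (h ht) hst
      · rintro s ⟨O, hO, hs⟩
        exact (hc hO).2.2 s hs)
  obtain ⟨hOD, hOo, hOp⟩ := hO.prop
  obtain ⟨q, hq⟩ := hM.exists_isRightSupport O
  have hqD : q ∈ D := hsup O hOD hOo q hq.isProjectionSup
  have hqp : q * p = q := hq.mul_eq_self_of_forall hOp
  have hpq : p * q = p := hp.mul_eq_self_of_forall fun s hs => by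
    -- The support of `s * (1 - q)` lies in `D`, under `p` and orthogonal to `O`. Maximality puts it
    -- in `O`, hence under `q`, so it vanishes.
    obtain ⟨r, hr⟩ := hM.exists_isRightSupport {s * (1 - q)}
    have hrq : r * q = 0 := by
      rw [← hr.mul_eq_zero_iff, mul_assoc, hq.isStarProjection.one_sub_mul_self, mul_zero]
    have hrp : r * (1 - p) = 0 := by
      rw [← hr.mul_eq_zero_iff, mul_assoc, sub_mul, one_mul, mul_sub q, hqp, mul_one, sub_self,
        sub_zero, mul_sub, mul_one, hp.mul_eq hs, sub_self]
    have hrO : ∀ o ∈ O, r * o = 0 := fun o ho => by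
      rw [← (hOo.isStarProjection o ho).mul_eq_left_comm hq.isStarProjection (hq.mul_eq ho),
        ← mul_assoc, hrq, zero_mul]
    have hmem : insert r O ∈
        {O : Set M | O ⊆ (D : Set M) ∧ IsOrthogonalProjectionSet O ∧ ∀ o ∈ O, o * p = o} := by
      refine ⟨Set.insert_subset (hsupp _ (D.mul_mem (hS hs) (D.sub_mem D.one_mem hqD)) r hr) hOD,
        ⟨?_, ?_⟩, ?_⟩
      · rintro o (rfl | ho)
        exacts [hr.isStarProjection, hOo.isStarProjection o ho]
      · rintro o (rfl | ho) o' (rfl | ho') hne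
        · exact (hne rfl).elim
        · exact hrO o' ho'
        · exact hr.isStarProjection.mul_eq_zero_comm (hOo.isStarProjection o ho) (hrO o ho)
        · exact hOo.orthogonal o ho o' ho' hne
      · rintro o (rfl | ho)
        · rw [mul_sub, mul_one, sub_eq_zero] at hrp
          exact hrp.symm
        · exact hOp o ho
    have hrmem : r ∈ O := hO.le_of_ge hmem (Set.subset_insert r O) (Set.mem_insert r O)
    have hr0 : r * 1 = 0 := by rw [mul_one, ← hq.mul_eq hrmem, hrq]
    rw [← hr.mul_eq_zero_iff, mul_one, mul_sub, mul_one, sub_eq_zero] at hr0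
    exact hr0.symm
  rwa [hpq.symm.trans (hq.isStarProjection.mul_eq_left_comm hp.isStarProjection hqp)]

theorem StarSubalgebra.isBaerStarRing (hM : IsBaerStarRing M) {D : StarSubalgebra ℂ M}
    (hD : ∀ S ⊆ (D : Set M), ∀ p, IsRightSupport S p → p ∈ D) : IsBaerStarRing D := by
  intro S
  obtain ⟨p, hp⟩ := hM.exists_isRightSupport ((↑) '' S : Set M)
  have hpD : p ∈ D := hD _ (by rintro _ ⟨x, -, rfl⟩; exact x.2) p hp
  refine ⟨1 - ⟨p, hpD⟩, IsStarProjection.one_sub ⟨Subtype.ext hp.isStarProjection.mul_self,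
    Subtype.ext hp.isStarProjection.star_eq⟩, fun x => ?_⟩
  have h1 := hp.iff (x : M)
  rw [Set.forall_mem_image] at h1
  rw [sub_mul, one_mul, sub_eq_self]
  simp only [Subtype.ext_iff]
  exact h1

namespace IsFaithfulNormal

variable {τ : M → ℂ}

/-- The spectral projections `e n` are not yet known to lie in `D`, but continuous functions of `h`
do. Such a function `f`, equal to `1` on `e n` and supported under `p`, satisfies `p - f = (p - e n)
* (1 - f)`, which is `2`-norm small. -/
theorem support_mem (hτ : IsFaithfulNormal τ) {D : StarSubalgebra ℂ M}
    (hD : quasiClosure τ (D : Set M) ⊆ D) {x p : M} (hx : x ∈ D) (hp : IsRightSupport {x} p) :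
    p ∈ D := by
  let _ := CStarAlgebra.spectralOrder M
  have := CStarAlgebra.spectralOrderedRing M
  have hcl : IsClosed (D : Set M) := hτ.isClosed_of_quasiClosure_subset hD
  set h := star x * x with hdef
  have hh : 0 ≤ h := star_mul_self_nonneg x
  have hhD : h ∈ D := mul_mem (star_mem hx) hx
  replace hp : IsRightSupport {h} p := IsRightSupport.star_mul_self_iff.2 hp
  obtain ⟨e, he, hmono, hy, hhe⟩ := hτ.baer.exists_seq hh
  have hrange := hp.range_of_approx hy hhe
  have hlim := hτ.normal.tendsto_re hτ.quasi (fun n => (he n).isStarProjection) hmono hrange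
  refine hD (mem_quasiClosure_iff.2 fun ε hε => ?_)
  -- The half absorbs the factor `2` in `sqNormTwo_mul_right_le`.
  obtain ⟨n, hn⟩ := (hlim.eventually (lt_mem_nhds (by linarith : (τ p).re - ε / 2 < _))).exists
  let g : ℝ → ℝ := fun s => min (((n : ℝ) + 1) * s) 1
  refine ⟨cfc g h, cfc_mem (hs := hcl) g hhD, ?_⟩
  have hg0 : ∀ s ∈ spectrum ℝ h, 0 ≤ g s := fun s hs =>
    le_min (mul_nonneg (by positivity) (spectrum_nonneg_of_nonneg hh hs)) zero_le_one
  have hge : cfc g h * e n = e n := by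
    rw [← ((he n).commute_cfc g).eq, (he n).mul_cfc_eq_smul hh.isSelfAdjoint (c := 1) (by fun_prop),
      one_smul]
    intro s _ hs
    refine min_eq_right ?_
    rw [div_lt_iff₀ (by positivity)] at hs
    linarith
  have hgp : p * cfc g h = cfc g h := by
    have h1 : cfc g h ≤ ((n : ℝ) + 1) • h := by
      have : ((n : ℝ) + 1) • h = cfc (fun s : ℝ => ((n : ℝ) + 1) * s) h := by
        rw [cfc_const_mul _ _ h (by fun_prop), cfc_id' ℝ h]
      rw [this]
      exact cfc_mono (fun s _ => min_le_left _ _) (by fun_prop) (by fun_prop)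
    have h2 := mul_eq_zero_of_le (y := 1 - p) (cfc_nonneg hg0) h1 (by
      rw [smul_mul_assoc, mul_sub, mul_one, hp.mul_eq rfl, sub_self, smul_zero])
    rw [mul_sub, mul_one, sub_eq_zero] at h2
    have h3 := congrArg star h2
    rw [star_mul, hp.isStarProjection.star_eq, (cfc_predicate g h : IsSelfAdjoint _).star_eq] at h3
    exact h3.symm
  have heg : e n * cfc g h = e n := by rw [((he n).commute_cfc g).eq, hge]
  have hep : e n * p = e n := hrange.mul_eq ⟨n, rfl⟩
  have hfac : p - cfc g h = (p - e n) * (1 - cfc g h) := by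
    rw [sub_mul, mul_sub, mul_sub, mul_one, mul_one, hgp, heg, sub_self, sub_zero]
  have hnorm : ‖1 - cfc g h‖ ≤ 1 := by
    have : 1 - cfc g h = cfc (fun s => 1 - g s) h := by
      rw [cfc_sub _ _ h (by fun_prop) (by fun_prop), cfc_const_one ℝ h]
    rw [this]
    refine norm_cfc_le zero_le_one fun s hs => ?_
    rw [Real.norm_eq_abs, abs_le]
    constructor <;> linarith [hg0 s hs, min_le_right (((n : ℝ) + 1) * s) 1]
  rw [hfac]
  refine (hτ.sqNormTwo_mul_right_le _ _).trans_lt ?_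
  have h4 := hτ.quasi.sqNormTwo_sub_of_mul_eq (he n).isStarProjection hp.isStarProjection hep
  have h5 := hτ.quasi.sqNormTwo_nonneg (p - e n)
  have h6 : ‖1 - cfc g h‖ ^ 2 ≤ 1 := pow_le_one₀ (norm_nonneg _) hnorm
  nlinarith

/-- Finite partial sums are subprojections of `p`, and their squared `2`-distance to `p` is the tail
of the series for `τ p`. -/
theorem sup_mem (hτ : IsFaithfulNormal τ) {D : StarSubalgebra ℂ M}
    (hD : quasiClosure τ (D : Set M) ⊆ D) {S : Set M} (hS : S ⊆ (D : Set M))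
    (hSo : IsOrthogonalProjectionSet S) {p : M} (hp : IsProjectionSup S p) : p ∈ D := by
  have hsum := hτ.normal S hSo p hp
  refine hD (mem_quasiClosure_iff.2 fun ε hε => ?_)
  have h1 := ((Complex.continuous_re.tendsto _).comp hsum).eventually
    (lt_mem_nhds (by linarith : (τ p).re - ε < _))
  obtain ⟨F, hF⟩ := h1.exists
  refine ⟨∑ s ∈ F, (s : M), D.sum_mem fun s _ => hS s.2, ?_⟩
  have key : ∀ F : Finset S, IsStarProjection (∑ s ∈ F, (s : M)) ∧
      (τ (∑ s ∈ F, (s : M))).re = (∑ s ∈ F, τ (s : M)).re := fun F => by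
    classical
    induction F using Finset.induction_on with
    | empty => simp [hτ.quasi.map_zero, IsStarProjection.zero]
    | insert a F ha ih =>
      have ho : (a : M) * ∑ s ∈ F, (s : M) = 0 := by
        rw [Finset.mul_sum]
        refine Finset.sum_eq_zero fun s hs => hSo.orthogonal a a.2 s s.2 fun h => ha ?_
        rwa [Subtype.ext h]
      have hap := hSo.isStarProjection a a.2
      have ho' := hap.mul_eq_zero_comm ih.1 ho
      rw [Finset.sum_insert ha, Finset.sum_insert ha, Complex.add_re, ← ih.2]
      exact ⟨hap.add ih.1 ho, hτ.quasi.re_add hap.isSelfAdjoint ih.1.isSelfAdjoint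
        (ho.trans ho'.symm)⟩
  have hle : (∑ s ∈ F, (s : M)) * p = ∑ s ∈ F, (s : M) := by
    rw [Finset.sum_mul]
    exact Finset.sum_congr rfl fun s _ => hp.upper s s.2
  rw [hτ.quasi.sqNormTwo_sub_of_mul_eq (key F).1 hp.isStarProjection hle, (key F).2]
  simp only [Function.comp_apply] at hF
  linarith

theorem isAWStarSubalgebra (hτ : IsFaithfulNormal τ) {D : StarSubalgebra ℂ M}
    (hD : quasiClosure τ (D : Set M) ⊆ D) : IsAWStarSubalgebra D where
  isClosed := hτ.isClosed_of_quasiClosure_subset hD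
  isBaerStarRing := StarSubalgebra.isBaerStarRing hτ.baer fun _ hS _ hp =>
    StarSubalgebra.support_set_mem hτ.baer (fun _ hx _ hp => hτ.support_mem hD hx hp)
      (fun _ hS hSo _ hp => hτ.sup_mem hD hS hSo hp) hS hp
  sup_mem _ hS hSo _ hp := hτ.sup_mem hD hS hSo hp

end IsFaithfulNormal

end Subalgebra

/-! ### `AW*`-subalgebras are `2`-norm closed. -/

section AWStarSubalgebra

variable {M : Type*} [CStarAlgebra M]

namespace IsAWStarSubalgebra

variable {C : StarSubalgebra ℂ M}

/-- A support computed in `C` could a priori differ from the one in `M`. The spectral projections `e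
n` of `C`, however, are tied to `x` by algebraic identities and norm estimates that persist in `M`,
so `p` is the supremum in `M` of their differences. -/
theorem support_mem (hC : IsAWStarSubalgebra C) {x p : M} (hx : x ∈ C)
    (hp : IsRightSupport {x} p) : p ∈ C := by
  have hcl : IsClosed (C : Set M) := hC.isClosed
  let _ : CStarAlgebra C := StarSubalgebra.cstarAlgebra C
  let _ := CStarAlgebra.spectralOrder C
  have := CStarAlgebra.spectralOrderedRing C
  have hC' : IsBaerStarRing C := hC.isBaerStarRing
  let x' : C := ⟨x, hx⟩
  obtain ⟨e, he, hmono, hy, hh⟩ := hC'.exists_seq (star_mul_self_nonneg x')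
  have hpe : ∀ n, IsStarProjection (e n : M) := fun n =>
    ⟨congrArg Subtype.val (he n).isStarProjection.mul_self,
      congrArg Subtype.val (he n).isStarProjection.star_eq⟩
  have hmono' : ∀ n, (e n : M) * e (n + 1) = e n := fun n => congrArg Subtype.val (hmono n)
  have hrange : IsRightSupport (Set.range fun n => (e n : M)) p := by
    refine (IsRightSupport.star_mul_self_iff.2 hp).range_of_approx (fun n => ?_) hh
    obtain ⟨y, hy⟩ := hy n
    exact ⟨y, congrArg Subtype.val hy⟩
  refine hC.sup_mem _ ?_ ⟨?_, ?_⟩ p hrange.range_projDiff.isProjectionSup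
  · rintro _ ⟨n, rfl⟩
    cases n with
    | zero => exact (e 0).2
    | succ k => exact sub_mem (e (k + 1)).2 (e k).2
  · rintro _ ⟨n, rfl⟩
    exact isStarProjection_projDiff hpe hmono' n
  · rintro _ ⟨m, rfl⟩ _ ⟨n, rfl⟩ hmn
    exact projDiff_mul_eq_zero hpe hmono' m n fun h => hmn (by rw [h])

theorem support_set_mem (hM : IsBaerStarRing M) (hC : IsAWStarSubalgebra C) {S : Set M}
    (hS : S ⊆ (C : Set M)) {p : M} (hp : IsRightSupport S p) : p ∈ C :=
  StarSubalgebra.support_set_mem hM (fun _ hx _ hp => hC.support_mem hx hp) hC.sup_mem hS hp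

end IsAWStarSubalgebra

namespace IsFaithfulNormal

variable {τ : M → ℂ} {C : StarSubalgebra ℂ M}

/-- Chebyshev's inequality. -/
theorem exists_proj_norm_mul_le (hτ : IsFaithfulNormal τ) (hC : IsAWStarSubalgebra C) {d : M}
    (hd : d ∈ C) {t : ℝ} (ht : 0 < t) :
    ∃ b ∈ C, IsStarProjection b ∧ t ^ 2 * (τ b).re ≤ sqNormTwo τ d ∧ ‖d * (1 - b)‖ ≤ t := by
  let _ := CStarAlgebra.spectralOrder M
  have := CStarAlgebra.spectralOrderedRing M
  have hh := star_mul_self_nonneg d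
  have ht2 : 0 ≤ t ^ 2 := by positivity
  obtain ⟨b, hb⟩ := hτ.baer.exists_isSpectralProj (star d * d) (t ^ 2)
  have hbp := hb.isStarProjection
  refine ⟨b, hC.support_mem (cfc_mem (hs := hC.isClosed) _ (mul_mem (star_mem hd) hd)) hb,
    hbp, ?_, ?_⟩
  · rw [← hτ.quasi.re_smul hbp.isSelfAdjoint, sqNormTwo]
    refine hτ.quasi.re_mono_of_commute ((IsSelfAdjoint.all (t ^ 2)).smul hbp.isSelfAdjoint)
      hh.isSelfAdjoint ((hb.commute hh.isSelfAdjoint).smul_left _) ?_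
    have h1 := hb.smul_le_cutoff_sub hh.isSelfAdjoint ht2
    rw [sub_zero, cutoff_zero hh] at h1
    exact h1.trans (sub_le_self _ (cutoff_nonneg _ _))
  · refine (sq_le_sq₀ (norm_nonneg _) ht.le).1 ?_
    rw [sq, ← CStarRing.norm_star_mul_self, star_mul, hbp.one_sub.star_eq, mul_assoc,
      ← mul_assoc (star d)]
    refine (norm_mul_le _ _).trans ?_
    have h2 := hb.norm_mul_one_sub_le hh ht2
    have h3 := hbp.one_sub.norm_le
    nlinarith [norm_nonneg (star d * d * (1 - b))]

/-- Egorov's theorem: an element of the `2`-norm closure of an `AW*`-subalgebra belongs to the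
subalgebra after cutting by a projection of small cotrace. -/
theorem exists_proj_mul_mem (hτ : IsFaithfulNormal τ) (hC : IsAWStarSubalgebra C) {x : M}
    (hx : x ∈ quasiClosure τ (C : Set M)) {ε : ℝ} (hε : 0 < ε) :
    ∃ u ∈ C, IsStarProjection u ∧ (τ u).re ≤ ε ∧ x * (1 - u) ∈ C := by
  let _ := CStarAlgebra.spectralOrder M
  have := CStarAlgebra.spectralOrderedRing M
  -- The quasi-triangle inequality turns `ε / 16` into `ε / 2`. Chebyshev at level `(1 / 2) ^ n`
  -- divides by `(1 / 4) ^ n`, leaving `ε / 2 * (1 / 2) ^ n`, whose sum is at most `ε`.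
  choose y hyC hy using fun n : ℕ =>
    mem_quasiClosure_iff.1 hx (ε / 16 * (1 / 8) ^ n) (by positivity)
  choose b hbC hb hbτ hbn using fun n : ℕ => hτ.exists_proj_norm_mul_le hC
    (sub_mem (hyC n) (hyC (n + 1))) (t := (1 / 2) ^ n) (by positivity)
  have hbε : ∀ n, (τ (b n)).re ≤ ε / 2 * (1 / 2) ^ n := fun n => by
    have h1 := hτ.sqNormTwo_sub_le (y n) x (y (n + 1))
    rw [sqNormTwo_sub_comm (y n) x] at h1
    have h2 : ((1 : ℝ) / 8) ^ (n + 1) ≤ (1 / 8) ^ n :=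
      pow_le_pow_of_le_one (by norm_num) (by norm_num) n.le_succ
    have h3 : ((1 : ℝ) / 2 ^ n) ^ 2 * (τ (b n)).re ≤ ε / 2 * (1 / 8) ^ n := by
      have := hbτ n
      rw [one_div_pow] at this
      have h5 := mul_le_mul_of_nonneg_left h2 (by positivity : 0 ≤ ε / 16)
      linarith [hy n, hy (n + 1)]
    have h4 : ((1 : ℝ) / 8) ^ n = (1 / 2 ^ n) ^ 2 * (1 / 2) ^ n := by
      rw [← one_div_pow, ← pow_mul, mul_comm n 2, pow_mul, ← mul_pow]; norm_num
    rw [h4, mul_left_comm] at h3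
    exact le_of_mul_le_mul_left h3 (by positivity)
  obtain ⟨u, hu⟩ := hτ.baer.exists_isRightSupport (Set.range b)
  have hup := hu.isStarProjection
  refine ⟨u, hC.support_set_mem hτ.baer (Set.range_subset_iff.2 hbC) hu, hup, ?_, ?_⟩
  · refine re_sup_range_le hτ.baer hτ.quasi hτ.normal hb hu fun n => ?_
    refine (Finset.sum_le_sum fun i _ => hbε i).trans ?_
    rw [← Finset.mul_sum]
    have h5 : ∑ i ∈ Finset.range n, ((1 : ℝ) / 2) ^ i ≤ 2 := sum_geometric_two_le n
    nlinarith
  -- Under `1 - u` every `1 - b n` acts as the identity, so the sequence is Cauchy in operator norm.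
  · have h1 : ∀ n, dist (y n * (1 - u)) (y (n + 1) * (1 - u)) ≤ 1 * (1 / 2 : ℝ) ^ n := fun n => by
      have h2 : (1 - b n) * (1 - u) = 1 - u := by
        rw [sub_mul, one_mul, mul_sub, mul_one, hu.mul_eq ⟨n, rfl⟩, sub_self, sub_zero]
      rw [dist_eq_norm, ← sub_mul, ← h2, ← mul_assoc, one_mul]
      refine (norm_mul_le _ _).trans ?_
      have h3 := hup.one_sub.norm_le
      have h4 := hbn n
      nlinarith [norm_nonneg ((y n - y (n + 1)) * (1 - b n))]
    obtain ⟨z, hz⟩ := cauchySeq_tendsto_of_complete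
      (cauchySeq_of_le_geometric (1 / 2) 1 (by norm_num) h1)
    have hzC : z ∈ C := hC.isClosed.mem_of_tendsto hz (Filter.Eventually.of_forall fun n =>
      mul_mem (hyC n) (sub_mem C.one_mem
        (hC.support_set_mem hτ.baer (Set.range_subset_iff.2 hbC) hu)))
    -- The norm limit `z` must equal the `2`-norm limit `x * (1 - u)`, by faithfulness.
    have h6 : ∀ n, sqNormTwo τ (x * (1 - u) - z) ≤
        4 * (2 * ‖1 - u‖ ^ 2 * (ε / 16 * (1 / 8) ^ n) +
          2 * ‖y n * (1 - u) - z‖ ^ 2 * (τ 1).re) := fun n => by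
      refine (hτ.sqNormTwo_sub_le _ (y n * (1 - u)) _).trans ?_
      gcongr
      · rw [← sub_mul]
        refine (hτ.sqNormTwo_mul_right_le _ _).trans ?_
        gcongr
        exact (hy n).le
      · exact hτ.sqNormTwo_le_norm _
    have h7 : Filter.Tendsto (fun n => 4 * (2 * ‖1 - u‖ ^ 2 * (ε / 16 * (1 / 8) ^ n) +
          2 * ‖y n * (1 - u) - z‖ ^ 2 * (τ 1).re)) Filter.atTop
        (nhds (4 * (2 * ‖1 - u‖ ^ 2 * (ε / 16 * 0) + 2 * 0 ^ 2 * (τ 1).re))) := by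
      have h8 := tendsto_pow_atTop_nhds_zero_of_lt_one (r := (1 / 8 : ℝ)) (by norm_num) (by norm_num)
      have h9 := tendsto_iff_norm_sub_tendsto_zero.1 hz
      exact (((h8.const_mul _).const_mul _).add (((h9.pow 2).const_mul _).mul_const _)).const_mul _
    have h10 := ge_of_tendsto' h7 h6
    have h11 : x * (1 - u) - z = 0 := hτ.eq_zero_of_sqNormTwo
      (le_antisymm (by simpa using h10) (hτ.quasi.sqNormTwo_nonneg _))
    rwa [sub_eq_zero.1 h11]

/-- `q` is the right support of the elements `(1 - u n) * q` of `C`: if all of them kill `y`, then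
`q * y = u n * (q * y)` has arbitrarily small `2`-norm. -/
theorem proj_mem_of_mem_quasiClosure (hτ : IsFaithfulNormal τ) (hC : IsAWStarSubalgebra C) {q : M}
    (hq : IsStarProjection q) (hx : q ∈ quasiClosure τ (C : Set M)) : q ∈ C := by
  choose u huC hu huτ hqu using fun n : ℕ => hτ.exists_proj_mul_mem hC hx
    (Nat.one_div_pos_of_nat (α := ℝ) (n := n))
  refine hC.support_set_mem hτ.baer (S := Set.range fun n => star (q * (1 - u n))) ?_ ⟨hq, ?_⟩
  · rintro _ ⟨n, rfl⟩
    exact star_mem (hqu n)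
  · intro y
    simp only [Set.forall_mem_range, star_mul, hq.star_eq, (hu _).one_sub.star_eq, mul_assoc]
    refine ⟨fun h => ?_, fun h n => by rw [h, mul_zero]⟩
    have h1 : ∀ n : ℕ, sqNormTwo τ (q * y) ≤ 2 * ‖q * y‖ ^ 2 * (1 / ((n : ℝ) + 1)) := fun n => by
      have h2 : q * y = u n * (q * y) := by
        have := h n
        rwa [sub_mul, one_mul, sub_eq_zero] at this
      have h3 := hτ.sqNormTwo_mul_right_le (u n) (q * y)
      rw [← h2] at h3
      refine h3.trans ?_
      gcongr
      rw [sqNormTwo, (hu n).star_eq, (hu n).mul_self]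
      exact huτ n
    have h4 := ge_of_tendsto' (tendsto_one_div_add_atTop_nhds_zero_nat.const_mul _) h1
    rw [mul_zero] at h4
    exact hτ.eq_zero_of_sqNormTwo (le_antisymm h4 (hτ.quasi.sqNormTwo_nonneg _))

end IsFaithfulNormal

/-- A norm closed subspace containing the spectral projections of the positive element `a`
contains `a`. -/
theorem StarSubalgebra.mem_of_forall_isSpectralProj {C : StarSubalgebra ℂ M} [PartialOrder M] [StarOrderedRing M] (hM : IsBaerStarRing M)
    (hC : IsClosed (C : Set M)) {a : M} (ha : 0 ≤ a)
    (h : ∀ t e, IsSpectralProj a t e → e ∈ C) : a ∈ C := by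
  have hsa := ha.isSelfAdjoint
  rw [← SetLike.mem_coe, ← hC.closure_eq]
  refine Metric.mem_closure_iff.2 fun ε hε => ?_
  obtain ⟨δ, hδ, hδε⟩ := exists_between hε
  choose e he using fun k : ℕ => hM.exists_isSpectralProj a (k * δ)
  obtain ⟨N, hN⟩ := exists_nat_ge (‖a‖ / δ)
  rw [div_le_iff₀ hδ] at hN
  have hp := fun k => (he k).isStarProjection
  refine ⟨δ • ∑ k ∈ Finset.range N, e (k + 1), ?_, lt_of_le_of_lt ?_ hδε⟩
  · rw [← Complex.coe_smul]
    exact C.smul_mem (sum_mem fun k _ => h _ _ (he (k + 1))) _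
  have hδk : ∀ k : ℕ, (k : ℝ) * δ ≤ (k + 1 : ℕ) * δ := fun k => by
    push_cast; linarith
  have hd : ∀ k : ℕ, ((k + 1 : ℕ) : ℝ) * δ - k * δ = δ := fun k => by push_cast; ring
  have htel : a = ∑ k ∈ Finset.range N, (cutoff a (k * δ) - cutoff a ((k + 1 : ℕ) * δ)) := by
    have h1 := Finset.sum_range_sub' (fun k : ℕ => cutoff a (k * δ)) N
    rw [cutoff_eq_zero hN] at h1
    simp only [Nat.cast_zero, zero_mul, cutoff_zero ha, sub_zero] at h1
    exact h1.symm
  have hlow : 0 ≤ a - δ • ∑ k ∈ Finset.range N, e (k + 1) := by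
    rw [sub_nonneg, Finset.smul_sum]
    conv_rhs => rw [htel]
    refine Finset.sum_le_sum fun k _ => ?_
    have := (he (k + 1)).smul_le_cutoff_sub hsa (hδk k)
    rwa [hd] at this
  -- The upper and lower sums differ by `δ • (e 0 - e N)`, which is at most `δ`.
  have hupp : a - δ • ∑ k ∈ Finset.range N, e (k + 1) ≤ δ • (1 : M) := by
    have h1 : a ≤ δ • ∑ k ∈ Finset.range N, e k := by
      rw [Finset.smul_sum]
      conv_lhs => rw [htel]
      refine Finset.sum_le_sum fun k _ => ?_
      have := (he k).cutoff_sub_le_smul hsa (hδk k)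
      rwa [hd] at this
    have h2 := Finset.sum_range_succ e N
    rw [Finset.sum_range_succ'] at h2
    have h3 : ∑ k ∈ Finset.range N, e k ≤ ∑ k ∈ Finset.range N, e (k + 1) + 1 := by
      rw [← sub_eq_iff_eq_add.2 h2]
      have h4 := (hp 0).le_one
      have h5 := (hp N).nonneg
      rw [sub_le_iff_le_add, add_assoc]
      exact add_le_add_right (h4.trans (le_add_of_nonneg_right h5)) _
    rw [sub_le_iff_le_add', ← smul_add]
    exact h1.trans (smul_le_smul_of_nonneg_left h3 hδ.le)
  rw [dist_eq_norm, CStarAlgebra.norm_le_iff_le_algebraMap _ hδ.le hlow,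
    Algebra.algebraMap_eq_smul_one]
  exact hupp

/-- The closure `D` of `C` contains the spectral projections of its positive elements, by
`IsFaithfulNormal.support_mem`. Being projections, these lie in `C`, and they recover the positive
elements in norm. -/
theorem IsFaithfulNormal.quasiClosure_subset {τ : M → ℂ} (hτ : IsFaithfulNormal τ)
    {C : StarSubalgebra ℂ M} (hC : IsAWStarSubalgebra C) : quasiClosure τ (C : Set M) ⊆ C := by
  let _ := CStarAlgebra.spectralOrder M
  have := CStarAlgebra.spectralOrderedRing M
  let D := hτ.quasiClosureSubalgebra C
  have hD : quasiClosure τ (D : Set M) ⊆ D := hτ.quasiClosure_quasiClosure_subset _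
  have hDcl : IsClosed (D : Set M) := hτ.isClosed_of_quasiClosure_subset hD
  have hpos : ∀ a ∈ D, 0 ≤ a → a ∈ C := fun a haD ha =>
    StarSubalgebra.mem_of_forall_isSpectralProj hτ.baer hC.isClosed ha fun t e he =>
      hτ.proj_mem_of_mem_quasiClosure hC he.isStarProjection
        (hτ.support_mem hD (cfc_mem (hs := hDcl) _ haD) he)
  have hsa : ∀ a ∈ D, IsSelfAdjoint a → a ∈ C := fun a haD ha => by
    have hr : ∀ E : StarSubalgebra ℂ M, algebraMap ℝ M ‖a‖ ∈ E := fun E => by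
      rw [Algebra.algebraMap_eq_smul_one, ← Complex.coe_smul]
      exact E.smul_mem E.one_mem _
    have h1 := hpos (a + algebraMap ℝ M ‖a‖) (add_mem haD (hr D)) (by
      rw [← neg_le_iff_add_nonneg]
      exact ha.neg_algebraMap_norm_le_self)
    rw [← add_sub_cancel_right a (algebraMap ℝ M ‖a‖)]
    exact sub_mem h1 (hr C)
  intro x hx
  have hxD : x ∈ D := hx
  have h1 := hsa (x + star x) (add_mem hxD (star_mem hxD)) (.add_star_self x)
  have h2 := hsa (Complex.I • (x - star x)) (D.smul_mem (sub_mem hxD (star_mem hxD)) _) (by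
    rw [IsSelfAdjoint, star_smul, star_sub, star_star, Complex.star_def, Complex.conj_I, neg_smul,
      ← smul_neg, neg_sub])
  have h3 : x = (1 / 2 : ℂ) • ((x + star x) - Complex.I • (Complex.I • (x - star x))) := by
    rw [smul_smul, Complex.I_mul_I, neg_one_smul, sub_neg_eq_add, add_add_sub_cancel, ← two_smul ℂ x,
      smul_smul]
    norm_num
  rw [SetLike.mem_coe, h3]
  exact C.smul_mem (sub_mem h1 (C.smul_mem h2 _)) _

end AWStarSubalgebra

theorem proposition3p12 {M : Type*} [CStarAlgebra M]
    (hM : IsAWStarAlgebra M) (hfin : IsFiniteStarAlgebra M)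
    (τ : M → ℂ) (hτ : IsQuasitrace τ) (hfaithful : IsFaithfulQuasitrace τ)
    (hnormal : IsNormalQuasitrace τ)
    (A : StarSubalgebra ℂ M) (hA : IsClosed (A : Set M)) :
    ∃ B : StarSubalgebra ℂ M, (B : Set M) = quasiClosure τ (A : Set M) ∧
      IsLeast {C : StarSubalgebra ℂ M | IsAWStarSubalgebra C ∧ A ≤ C} B := by
  have h : IsFaithfulNormal τ := ⟨hM, hτ.isOneQuasitrace, hnormal, hfaithful⟩
  refine ⟨h.quasiClosureSubalgebra A, rfl, ⟨h.isAWStarSubalgebra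
    (h.quasiClosure_quasiClosure_subset _), h.quasi.subset_quasiClosure _⟩, ?_⟩
  rintro C ⟨hC, hAC⟩
  exact (quasiClosure_mono hAC).trans (h.quasiClosure_subset hC)
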